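/- Let $(W,S)$ be a Coxeter system of arbitrary type with Coxeter matrix $(m_{s,t})_{s,t\in S}$, i.e. $m_{s,s}=1$, $m_{s,t}=m_{t,s}\in\{2,3,\dots\}\cup\{\infty\}$ for $s\neq t$, and $W$ is the group generated by $S$ subject to the relations $(st)^{m_{s,t}}=1$ for all $s,t\in S$ with $m_{s,t}<\infty$ (no finiteness of $S$ or of $W$ is assumed). Let $$\mathrm{Br}(W,S)=\Big\langle s\in S \ \Big|\ \underbrace{sts\cdots}_{m_{s,t}\text{ terms}}=\underbrace{tst\cdots}_{m_{s,t}\text{ terms}}\ \text{ for all } s\neq t \text{ in } S \text{ with } m_{s,t}<\infty\Big\rangle$$ be the (generalized) braid group, the presentation being taken in the category of groups, and let $\mathrm{Br}^+(W,S)$ be the positive braid monoid, defined by the same presentation in the category of monoids. Then the canonical morphism of monoids $\mathrm{Br}^+(W,S)\to\mathrm{Br}(W,S)$, which is the identity on the generators $s\in S$, is injective. -/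

import Mathlib

namespace CoxeterMatrix

variable {B : Type*} (M : CoxeterMatrix B)

/-- The braid relations `s t s ⋯ = t s t ⋯` (`M s t` letters on each side), as a relation on the
free monoid on the generators. The word `CoxeterSystem.braidWord M s t` is the alternating word in
`s` and `t` of length `M s t` that ends in `t`; together with `CoxeterSystem.braidWord M t s` it
gives the two alternating words of that length. If `M s t = 0`, which encodes `m_{s,t} = ∞`, both
words are empty and there is no relation between `s` and `t`; if `s = t`, the relation is
trivial. -/
def MonoidBraidRel (a b : FreeMonoid B) : Prop :=
  ∃ s t : B, a = FreeMonoid.ofList (CoxeterSystem.braidWord M s t) ∧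
    b = FreeMonoid.ofList (CoxeterSystem.braidWord M t s)

/-- The braid relations as a set of relators `(s t s ⋯) (t s t ⋯)⁻¹` in the free group. -/
def groupBraidRels : Set (FreeGroup B) :=
  {r | ∃ s t : B, r = ((CoxeterSystem.braidWord M s t).map FreeGroup.of).prod *
    ((CoxeterSystem.braidWord M t s).map FreeGroup.of).prod⁻¹}

/-- The positive braid monoid of a Coxeter matrix: the monoid presented by the generators and the
braid relations. -/
abbrev BraidMonoid : Type _ := PresentedMonoid M.MonoidBraidRel

/-- The (generalized) braid group of a Coxeter matrix: the group presented by the generators and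
the braid relations. -/
abbrev BraidGroup : Type _ := PresentedGroup M.groupBraidRels

/-- The generators of the braid group satisfy the braid relations. -/
theorem braidGroup_of_rel (a b : FreeMonoid B) (h : M.MonoidBraidRel a b) :
    FreeMonoid.lift (fun s : B => (PresentedGroup.of s : M.BraidGroup)) a =
      FreeMonoid.lift (fun s : B => (PresentedGroup.of s : M.BraidGroup)) b := by
  obtain ⟨s, t, rfl, rfl⟩ := h
  have key : ∀ l : List B,
      FreeMonoid.lift (fun s : B => (PresentedGroup.of s : M.BraidGroup)) (FreeMonoid.ofList l) =
        PresentedGroup.mk M.groupBraidRels ((l.map FreeGroup.of).prod) := by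
    intro l
    rw [FreeMonoid.lift_ofList, map_list_prod, List.map_map]
    rfl
  rw [key, key, ← mul_inv_eq_one, ← map_inv, ← map_mul]
  exact PresentedGroup.one_of_mem ⟨s, t, rfl⟩

/-- The canonical monoid morphism from the positive braid monoid to the braid group, which is the
identity on generators. -/
def braidMonoidToGroup : M.BraidMonoid →* M.BraidGroup :=
  PresentedMonoid.lift (fun s : B => (PresentedGroup.of s : M.BraidGroup)) M.braidGroup_of_rel

theorem braidMonoidToGroup_of (s : B) :
    M.braidMonoidToGroup (PresentedMonoid.of M.MonoidBraidRel s) = PresentedGroup.of s := rfl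

end CoxeterMatrix

namespace CoxeterSystem

variable {B W : Type*} [Group W] {M : CoxeterMatrix B}

/-- The positive braid monoid `Br⁺(W, S)` of a Coxeter system. It depends on the system only
through its Coxeter matrix. -/
abbrev BraidMonoid (_cs : CoxeterSystem M W) : Type _ := M.BraidMonoid

/-- The braid group `Br(W, S)` of a Coxeter system. It depends on the system only through its
Coxeter matrix. -/
abbrev BraidGroup (_cs : CoxeterSystem M W) : Type _ := M.BraidGroup

/-- The canonical monoid morphism `Br⁺(W, S) → Br(W, S)`. -/
abbrev braidMonoidToGroup (cs : CoxeterSystem M W) : cs.BraidMonoid →* cs.BraidGroup :=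
  M.braidMonoidToGroup

end CoxeterSystem

/-!
The braid monoid of a Coxeter matrix is embedded into a group in three steps.

*Simply laced matrices.* If all entries off the diagonal are two or three, the braid monoid acts by
invertible operations on quasi-isomorphism classes of differential graded modules over the zigzag
algebra of the Coxeter graph, with coefficients in the field with two elements, and the action
separates elements of equal length. The generator `s` acts by the spherical twist along the projective module `P_s`: the cone of the counit
`P_s ⊗ X_s ⟶ X`. A twist is invertible up to a shift, the inverse being the cone of the unit
`X ⟶ P_s ⊗ X_s` (`Zigzag.DerivedClass.twist_bijective`). The braid relation (`Zigzag.DGMod.twist_braid`)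
comes from applying the twists at `s` and at `t` to the cone that defines the twist at `t`: for
adjacent `s` and `t`, they take the functor `P_t ⊗ X_t` to the functor `P_s ⊗ (-)_s` of the twisted
module, up to a shift (`Zigzag.DGMod.braidGen_qis`, `Zigzag.DGMod.braidFree_qis`).

Start with the module that has a one-dimensional cohomology in degree zero at every vertex. The
lowest degree in which the cohomology of its translate by `b` can be nonzero drops by two with every
letter of `b`, and `s` divides `b` on the left if and only if the cohomology at `s` vanishes in that
degree (`CoxeterMatrix.gen_dvd_iff_van`). So the letters of a word can be recovered one by one from
the translate and the length, and elements of equal length with the same action are equal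
(`CoxeterMatrix.eq_of_orbit_eq`). As a byproduct, the monoid is left cancellative, and the
alternating product is the least common multiple of two generators.

*Finite entries with a common bound.* If `M s t - 1` divides `N > 0` for all `s ≠ t`, the map that
takes `s` to the product of `N` commuting copies of `s` is a homomorphism from the braid monoid to a
simply laced one, in which the copies of `s` and `t` form chains of type `A` with `M s t - 1`
elements (`CoxeterMatrix.unfold`). It exists because in type `A_n` the two alternating products
of length `n + 1` of the two halves of the Coxeter graph are the half twist
(`IsBraidSeq.altHalf_eq_halfTwist`). Since the half twist is the least common multiple of the
generators (`CoxeterMatrix.IsChain.halfTwist_dvd`), the homomorphism respects least common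
multiples, and such a homomorphism is injective on elements of equal length
(`CoxeterMatrix.IsLcmHom.eq_of_map_eq`). Together with the action above this gives the claim, as the
length of an element can be read off in the braid group.

*The general case.* An equality in the braid group uses finitely many finite entries of `M`. All
other entries can be replaced by a large finite number without affecting this equality, and without
affecting the equality of short words in the monoid (`CoxeterMatrix.mk_eq_mk_of_truncate`).

Cohomological degrees are written as `n + 1`, `n + 1 + 1`, and so on, so that shifts and differentials
compose definitionally. No signs occur, as the characteristic is two.
-/

universe u

/-! ### Complexes and differential graded modules over the zigzag algebra -/

namespace Zigzag

/-- A cochain complex of vector spaces over the field with two elements, written additively. -/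
structure Cpx where
  /-- The cochains of a given degree. -/
  C : ℤ → Type
  [grp : ∀ n, AddCommGroup (C n)]
  add_self : ∀ {n} (v : C n), v + v = 0
  /-- The differential. -/
  d : ∀ {n}, C n →+ C (n + 1)
  d_d : ∀ {n} (v : C n), d (d v) = 0

attribute [instance] Cpx.grp
attribute [simp] Cpx.add_self Cpx.d_d

namespace Cpx

theorem add_self_add (V : Cpx) {n : ℤ} (v w : V.C n) : v + (v + w) = w := by
  rw [← add_assoc, V.add_self, zero_add]

theorem eq_of_add_eq_zero (V : Cpx) {n : ℤ} {v w : V.C n} (h : v + w = 0) : v = w := by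
  rw [← add_right_cancel_iff (a := w), h, V.add_self]

theorem eq_add_of_add_eq (V : Cpx) {n : ℤ} {u v w : V.C n} (h : u + v = w) : u = w + v := by
  rw [← h, add_assoc, V.add_self, add_zero]

/-- The shift `V[1]`. -/
abbrev sh (V : Cpx) : Cpx where
  C n := V.C (n + 1)
  add_self v := V.add_self v
  d := V.d
  d_d v := V.d_d v

/-- A chain map. -/
structure Hom (V W : Cpx) where
  /-- The components of the chain map. -/
  f : ∀ {n}, V.C n →+ W.C n
  comm_d : ∀ {n} (v : V.C n), f (V.d v) = W.d (f v)

attribute [simp] Hom.comm_d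

/-- The composite chain map `g ∘ f`. -/
abbrev Hom.comp {U V W : Cpx} (g : Hom V W) (f : Hom U V) : Hom U W where
  f := g.f.comp f.f
  comm_d v := by simp

/-- The shift of a chain map. -/
abbrev Hom.sh {V W : Cpx} (f : Hom V W) : Hom V.sh W.sh where
  f := f.f
  comm_d v := f.comm_d v

/-- A chain map is a quasi-isomorphism if it is injective and surjective on cohomology. Every
integer is of the form `n + 1`, so that all degrees are covered. -/
structure Hom.Qis {V W : Cpx} (f : Hom V W) : Prop where
  inj : ∀ {n} (v : V.C (n + 1)) (w : W.C n), V.d v = 0 → f.f v = W.d w → ∃ u : V.C n, V.d u = v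
  surj : ∀ {n} (w : W.C (n + 1)), W.d w = 0 →
    ∃ v : V.C (n + 1), V.d v = 0 ∧ ∃ u : W.C n, w = f.f v + W.d u

variable {U V W : Cpx}

/-- Lifting of a pair in the cone of a quasi-isomorphism `f`: a cocycle `v` and a cochain `w` with
`f v = d w` come from `v'` and `w'`. This is the acyclicity of the cone. -/
theorem Hom.Qis.lift {f : Hom V W} (hf : f.Qis) {n : ℤ} (v : V.C (n + 1 + 1)) (w : W.C (n + 1))
    (hv : V.d v = 0) (h : f.f v = W.d w) :
    ∃ (v' : V.C (n + 1)) (w' : W.C n), V.d v' = v ∧ w = f.f v' + W.d w' := by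
  obtain ⟨v₀, rfl⟩ := hf.inj v w hv h
  obtain ⟨v₁, h₁, w', h₂⟩ := hf.surj (w + f.f v₀) (by rw [map_add, ← h, f.comm_d, W.add_self])
  refine ⟨v₀ + v₁, w', by rw [map_add, h₁, add_zero], ?_⟩
  rw [map_add, add_assoc, ← h₂, add_comm w, W.add_self_add]

theorem Hom.Qis.comp {g : Hom V W} {f : Hom U V} (hg : g.Qis) (hf : f.Qis) :
    (g.comp f).Qis where
  inj v w hv h := by
    obtain ⟨u, hu⟩ := hg.inj (f.f v) w (by rw [← f.comm_d, hv, map_zero]) h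
    exact hf.inj v u hv hu.symm
  surj w hw := by
    obtain ⟨v, hv, w', rfl⟩ := hg.surj w hw
    obtain ⟨u, hu, v', rfl⟩ := hf.surj v hv
    exact ⟨u, hu, g.f v' + w', by simp [add_assoc]⟩

/-- If `g` and `g ∘ f` are quasi-isomorphisms, then so is `f`. -/
theorem Hom.Qis.of_comp {g : Hom V W} {f : Hom U V} (hg : g.Qis) (hgf : (g.comp f).Qis) :
    f.Qis where
  inj v w hv h := hgf.inj v (g.f w) hv (by simp [h])
  surj v hv := by
    obtain ⟨u, hu, w, h⟩ := hgf.surj (g.f v) (by rw [← g.comm_d, hv, map_zero])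
    obtain ⟨v', hv'⟩ := hg.inj (v + f.f u) w
      (by rw [map_add, hv, ← f.comm_d, hu, map_zero, add_zero])
      (by rw [map_add, h, AddMonoidHom.comp_apply, add_right_comm, W.add_self, zero_add])
    exact ⟨u, hu, v', by rw [hv', add_comm v, V.add_self_add]⟩

theorem Hom.Qis.of_bijective {f : Hom V W} (hi : ∀ {n}, Function.Injective (f.f (n := n)))
    (hs : ∀ {n}, Function.Surjective (f.f (n := n))) : f.Qis where
  inj {n} v w hv h := by
    obtain ⟨u, rfl⟩ := hs w
    exact ⟨u, hi (by rw [f.comm_d, h])⟩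
  surj w hw := by
    obtain ⟨v, rfl⟩ := hs w
    exact ⟨v, hi (by rw [f.comm_d, hw, map_zero]), 0, by simp⟩

/-- A section of a chain map `r` that is onto up to boundaries is a quasi-isomorphism. -/
theorem Hom.Qis.of_retraction {f : Hom V W} (r : Hom W V) (hr : ∀ {n} (v : V.C n), r.f (f.f v) = v)
    (h : ∀ {n} (w : W.C (n + 1)), W.d w = 0 → ∃ u : W.C n, w = f.f (r.f w) + W.d u) :
    f.Qis where
  inj v w _ e := ⟨r.f w, by rw [← r.comm_d, ← e, hr]⟩
  surj w hw := ⟨r.f w, by rw [← r.comm_d, hw, map_zero], h w hw⟩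

theorem Hom.Qis.sh {f : Hom V W} (hf : f.Qis) : f.sh.Qis where
  inj v w hv h := hf.inj v w hv h
  surj w hw := hf.surj w hw

/-- `V.Van n` says that the cohomology of `V` vanishes in degree `n + 1`. -/
def Van (V : Cpx) (n : ℤ) : Prop := ∀ v : V.C (n + 1), V.d v = 0 → ∃ u : V.C n, V.d u = v

theorem Hom.Qis.van_iff {f : Hom V W} (hf : f.Qis) (n : ℤ) : V.Van n ↔ W.Van n := by
  constructor
  · intro h w hw
    obtain ⟨v, hv, u, rfl⟩ := hf.surj w hw
    obtain ⟨v', rfl⟩ := h v hv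
    exact ⟨f.f v' + u, by simp⟩
  · intro h v hv
    obtain ⟨w, hw⟩ := h (f.f v) (by rw [← f.comm_d, hv, map_zero])
    exact hf.inj v w hv hw.symm

end Cpx

/-- A differential graded module over the zigzag algebra of a simple graph, over the field with two
elements. It is given by a complex at every vertex, for every pair of vertices the action `x i j` of
the edge from `j` to `i` (zero if there is none), of degree one, and the action `l i` of the loop at
`i`, of degree two. -/
structure DGMod {I : Type u} (Γ : SimpleGraph I) where
  /-- The complex at a vertex. -/
  cpx : I → Cpx
  /-- The action of an edge. -/
  x : ∀ (i j : I) {n}, (cpx j).C n →+ (cpx i).C (n + 1)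
  /-- The action of a loop. -/
  l : ∀ (i : I) {n}, (cpx i).C n →+ (cpx i).C (n + 1 + 1)
  x_d : ∀ {i j n} (v : (cpx j).C n), x i j ((cpx j).d v) = (cpx i).d (x i j v)
  l_d : ∀ {i n} (v : (cpx i).C n), l i ((cpx i).d v) = (cpx i).d (l i v)
  x_not_adj : ∀ {i j n} (v : (cpx j).C n), ¬ Γ.Adj i j → x i j v = 0
  x_x : ∀ {i j n} (v : (cpx i).C n), Γ.Adj i j → x i j (x j i v) = l i v
  x_x_ne : ∀ {i j k n} (v : (cpx k).C n), i ≠ k → x i j (x j k v) = 0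
  x_l : ∀ {i j n} (v : (cpx j).C n), x i j (l j v) = 0
  l_x : ∀ {i j n} (v : (cpx j).C n), l i (x i j v) = 0
  l_l : ∀ {i n} (v : (cpx i).C n), l i (l i v) = 0

attribute [simp] DGMod.x_d DGMod.l_d DGMod.x_l DGMod.l_x DGMod.l_l

variable {I : Type u} {Γ : SimpleGraph I}

namespace DGMod

/-- The shift `X[1]`. -/
abbrev sh (X : DGMod Γ) : DGMod Γ where
  cpx i := (X.cpx i).sh
  x i j _ := X.x i j
  l i _ := X.l i
  x_d v := X.x_d v
  l_d v := X.l_d v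
  x_not_adj v h := X.x_not_adj v h
  x_x v h := X.x_x v h
  x_x_ne v h := X.x_x_ne v h
  x_l v := X.x_l v
  l_x v := X.l_x v
  l_l v := X.l_l v

/-- A morphism of differential graded modules, of degree zero. -/
structure Hom (X Y : DGMod Γ) where
  /-- The chain map at a vertex. -/
  hom : ∀ i, (X.cpx i).Hom (Y.cpx i)
  comm_x : ∀ {i j n} (v : (X.cpx j).C n), (hom i).f (X.x i j v) = Y.x i j ((hom j).f v)
  comm_l : ∀ {i n} (v : (X.cpx i).C n), (hom i).f (X.l i v) = Y.l i ((hom i).f v)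

attribute [simp] Hom.comm_x Hom.comm_l

variable {X Y Z X' Y' : DGMod Γ}

/-- The composite morphism `g ∘ f`. -/
abbrev Hom.comp (g : Hom Y Z) (f : Hom X Y) : Hom X Z where
  hom i := (g.hom i).comp (f.hom i)
  comm_x v := by simp
  comm_l v := by simp

/-- The shift of a morphism. -/
abbrev Hom.sh (f : Hom X Y) : Hom X.sh Y.sh where
  hom i := (f.hom i).sh
  comm_x v := f.comm_x v
  comm_l v := f.comm_l v

/-- A quasi-isomorphism of differential graded modules. -/
def Hom.Qis (f : Hom X Y) : Prop := ∀ i, (f.hom i).Qis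

theorem Hom.Qis.comp {g : Hom Y Z} {f : Hom X Y} (hg : g.Qis) (hf : f.Qis) : (g.comp f).Qis :=
  fun i => (hg i).comp (hf i)

theorem Hom.Qis.of_comp {g : Hom Y Z} {f : Hom X Y} (hg : g.Qis) (hgf : (g.comp f).Qis) : f.Qis :=
  fun i => (hg i).of_comp (hgf i)

theorem Hom.Qis.sh {f : Hom X Y} (hf : f.Qis) : f.sh.Qis := fun i => (hf i).sh

/-- The mapping cone of a morphism `f : Y ⟶ X`, with underlying graded module `X ⊕ Y[1]`. -/
abbrev cone (f : Hom Y X) : DGMod Γ where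
  cpx i :=
    { C := fun n => (X.cpx i).C n × (Y.cpx i).C (n + 1)
      add_self := fun v => by ext <;> simp
      d := fun {n} => AddMonoidHom.mk'
        (fun v => ((X.cpx i).d v.1 + (f.hom i).f v.2, (Y.cpx i).d v.2))
        (fun v w => by ext <;> simp; abel)
      d_d := fun v => by ext <;> simp }
  x i j _ := AddMonoidHom.mk' (fun v => (X.x i j v.1, Y.x i j v.2)) (fun v w => by ext <;> simp)
  l i _ := AddMonoidHom.mk' (fun v => (X.l i v.1, Y.l i v.2)) (fun v w => by ext <;> simp)
  x_d v := by ext <;> simp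
  l_d v := by ext <;> simp
  x_not_adj v h := by ext <;> simp [x_not_adj _ _ h]
  x_x v h := by ext <;> simp [x_x _ _ h]
  x_x_ne v h := by ext <;> simp [x_x_ne _ _ h]
  x_l v := by ext <;> simp
  l_x v := by ext <;> simp
  l_l v := by ext <;> simp

/-- The morphism of cones induced by a commutative square. -/
abbrev coneMap {f : Hom Y X} {f' : Hom Y' X'} (g : Hom X X') (h : Hom Y Y')
    (comm : ∀ i {n} (v : (Y.cpx i).C n), (g.hom i).f ((f.hom i).f v) = (f'.hom i).f ((h.hom i).f v)) :
    Hom (cone f) (cone f') where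
  hom i :=
    { f := AddMonoidHom.mk' (fun v => ((g.hom i).f v.1, (h.hom i).f v.2))
        (fun v w => by ext <;> simp)
      comm_d := fun v => by ext <;> simp [comm] }
  comm_x v := by ext <;> simp
  comm_l v := by ext <;> simp

/-- The five lemma for cones. -/
theorem coneMap_qis {f : Hom Y X} {f' : Hom Y' X'} {g : Hom X X'} {h : Hom Y Y'}
    (comm : ∀ i {n} (v : (Y.cpx i).C n), (g.hom i).f ((f.hom i).f v) = (f'.hom i).f ((h.hom i).f v))
    (hg : g.Qis) (hh : h.Qis) : (coneMap g h comm).Qis := by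
  intro i
  constructor
  · rintro n ⟨x, y⟩ ⟨x₁, y₁⟩ hv hw
    simp only [AddMonoidHom.mk'_apply, Prod.mk_eq_zero, Prod.mk.injEq] at hv hw
    obtain ⟨y', y'', rfl, rfl⟩ := (hh i).lift y y₁ hv.2 hw.2
    obtain ⟨x', hx'⟩ := (hg i).inj (x + (f.hom i).f y') (x₁ + (f'.hom i).f y'')
      (by simpa using hv.1) (by
        rw [map_add, hw.1, comm]
        simp only [map_add, Cpx.Hom.comm_d]
        rw [add_right_comm, add_assoc, Cpx.add_self_add])
    refine ⟨(x', y'), ?_⟩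
    ext
    · simp [hx', add_assoc]
    · simp
  · rintro n ⟨x₁, y₁⟩ hw
    simp only [AddMonoidHom.mk'_apply, Prod.mk_eq_zero] at hw
    obtain ⟨y, hy, w, rfl⟩ := (hh i).surj y₁ hw.2
    obtain ⟨x, w', hx, hx'⟩ := (hg i).lift ((f.hom i).f y) (x₁ + (f'.hom i).f w)
      (by rw [← Cpx.Hom.comm_d, hy, map_zero]) (by
        have := (X'.cpx i).eq_of_add_eq_zero hw.1
        rw [map_add, this, comm]
        simp [add_assoc])
    refine ⟨(x, y), ?_, (w', w), ?_⟩
    · simp [hx, hy]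
    · have := (X'.cpx i).eq_add_of_add_eq hx'.symm.symm
      ext
      · simp [this, add_assoc]
      · simp

/-- The inclusion of the target into a cone. -/
abbrev coneInl (f : Hom Y X) : Hom X (cone f) where
  hom i :=
    { f := AddMonoidHom.mk' (fun v => (v, 0)) (fun v w => by ext <;> simp)
      comm_d := fun v => by ext <;> simp }
  comm_x v := by ext <;> simp
  comm_l v := by ext <;> simp

/-- The projection of a cone onto the shifted source. -/
abbrev coneSnd (f : Hom Y X) : Hom (cone f) Y.sh where
  hom i :=
    { f := AddMonoidHom.mk' (fun v => v.2) (fun v w => by simp)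
      comm_d := fun v => by simp }
  comm_x v := by simp
  comm_l v := by simp

/-- The cone of the inclusion `X ⟶ cone f` projects onto `Y[1]`. -/
abbrev coneConeInl (f : Hom Y X) : Hom (cone (coneInl f)) Y.sh where
  hom i :=
    { f := AddMonoidHom.mk' (fun v => v.1.2) (fun v w => by simp)
      comm_d := fun v => by simp }
  comm_x v := by simp
  comm_l v := by simp

theorem coneConeInl_qis (f : Hom Y X) : (coneConeInl f).Qis := by
  intro i
  constructor
  · rintro n ⟨⟨x, y⟩, x'⟩ w hv hw
    simp only [AddMonoidHom.mk'_apply, Prod.mk_eq_zero, Prod.mk_add_mk, add_zero] at hv hw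
    subst hw
    refine ⟨((0, w), x + (f.hom i).f w), ?_⟩
    have := (X.cpx i).eq_of_add_eq_zero hv.1.1
    ext
    · simp
      rw [add_comm x, (X.cpx i).add_self_add]
    · simp
    · simpa using this
  · intro n w hw
    refine ⟨((0, w), (f.hom i).f w), ?_, 0, by simp⟩
    have hw' : (Y.cpx i).d w = 0 := hw
    ext
    · simp
    · simp [hw']
    · simp [← Cpx.Hom.comm_d, hw']

/-- The inclusion of `X[1]` into the cone of the projection `cone f ⟶ Y[1]`. -/
abbrev inrConeSnd (f : Hom Y X) : Hom X.sh (cone (coneSnd f)) where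
  hom i :=
    { f := AddMonoidHom.mk' (fun v => (0, (v, 0))) (fun v w => by ext <;> simp)
      comm_d := fun v => by ext <;> simp }
  comm_x v := by ext <;> simp
  comm_l v := by ext <;> simp

theorem inrConeSnd_qis (f : Hom Y X) : (inrConeSnd f).Qis := by
  intro i
  constructor
  · rintro n v ⟨y, x, y'⟩ hv hw
    simp only [AddMonoidHom.mk'_apply, Prod.mk.injEq] at hv hw
    obtain rfl := (Y.cpx i).eq_of_add_eq_zero hw.1.symm
    exact ⟨x + (f.hom i).f y, by simpa using hw.2.1.symm⟩
  · rintro n ⟨y, x, y'⟩ hw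
    simp only [AddMonoidHom.mk'_apply, Prod.mk_eq_zero] at hw
    obtain rfl := (Y.cpx i).eq_of_add_eq_zero hw.1
    refine ⟨x + (f.hom i).f y, by simpa using hw.2.1, (0, (0, y)), ?_⟩
    ext <;> simp [add_assoc]

end DGMod

/-! ### Free modules -/

/-- The group `A` if the proposition `p` holds, and the trivial group otherwise. -/
abbrev On (p : Prop) (A : Type) : Type := PLift p → A

open Classical in
/-- The canonical map from `On p A` to `A`; it vanishes if `p` does not hold. -/
noncomputable def ev {p : Prop} {A : Type} [AddCommGroup A] : On p A →+ A :=
  AddMonoidHom.mk' (fun a => if h : p then a ⟨h⟩ else 0)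
    (fun a b => by by_cases h : p <;> simp [h])

theorem ev_pos {p : Prop} {A : Type} [AddCommGroup A] (h : p) (a : On p A) : ev a = a ⟨h⟩ := by
  simp [ev, h]

theorem ev_neg {p : Prop} {A : Type} [AddCommGroup A] (h : ¬p) (a : On p A) : ev a = 0 := by
  simp [ev, h]

@[simp] theorem ev_self {α : Type*} {i : α} {A : Type} [AddCommGroup A] (a : On (i = i) A) :
    ev a = a ⟨rfl⟩ := ev_pos rfl a

@[simp] theorem ev_adj_self {i : I} {A : Type} [AddCommGroup A] (a : On (Γ.Adj i i) A) :
    ev a = 0 := ev_neg Γ.irrefl a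

theorem map_ev {p : Prop} {A B : Type} [AddCommGroup A] [AddCommGroup B] (f : A →+ B)
    (a : On p A) : f (ev a) = ev (fun h => f (a h)) := by
  by_cases h : p
  · simp [ev_pos h]
  · simp [ev_neg h]

@[simp] theorem ev_zero {p : Prop} {A : Type} [AddCommGroup A] :
    ev (fun _ : PLift p => (0 : A)) = 0 := map_zero ev

namespace DGMod

/-- The free module `P_s ⊗ V[2]` on a complex `V` placed at the vertex `s`. The module `P_s` has the
idempotent and the loop at `s`, and an arrow from `s` to every neighbour of `s` as basis; the three
factors are the corresponding components, which are present only at the appropriate vertices. -/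
noncomputable abbrev free (Γ : SimpleGraph I) (s : I) (V : Cpx) : DGMod Γ where
  cpx i :=
    { C := fun n => On (i = s) (V.C (n + 1 + 1)) × On (Γ.Adj i s) (V.C (n + 1)) × On (i = s) (V.C n)
      add_self := fun v => by ext <;> simp
      d := fun {n} => AddMonoidHom.mk'
        (fun v => (fun h => V.d (v.1 h), fun h => V.d (v.2.1 h), fun h => V.d (v.2.2 h)))
        (fun v w => by ext <;> simp)
      d_d := fun v => by ext <;> simp }
  x i j _ := AddMonoidHom.mk' (fun v => (0, fun _ => ev v.1, fun _ => ev v.2.1))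
    (fun v w => by ext <;> simp)
  l i _ := AddMonoidHom.mk' (fun v => (0, 0, v.1)) (fun v w => by ext <;> simp)
  x_d v := by ext <;> simp [map_ev]
  l_d v := by ext <;> simp
  x_not_adj {i j n} v h := by
    ext h'
    · simp
    · have : j ≠ s := by rintro rfl; exact h h'.down
      simp [ev_neg this]
    · have : ¬ Γ.Adj j s := by obtain ⟨rfl⟩ := h'; exact fun h' => h h'.symm
      simp [ev_neg this]
  x_x {i j n} v h := by
    ext h'
    · simp
    · simp
    · obtain ⟨rfl⟩ := h'
      simp [ev_pos h.symm]
  x_x_ne {i j k n} v h := by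
    ext h'
    · simp
    · simp
    · obtain ⟨rfl⟩ := h'
      have : k ≠ i := h.symm
      simp [ev_neg this]
  x_l v := by ext <;> simp
  l_x v := by ext <;> simp
  l_l v := by ext <;> simp

end DGMod

/-! ### The counit, the unit and the spherical twists -/

namespace DGMod

variable {X Y : DGMod Γ} {V W : Cpx}

open Classical in
/-- The identity from the complex at `j` to the complex at `i` if `i = j`, and zero otherwise. -/
noncomputable def tr (X : DGMod Γ) (i j : I) {n : ℤ} : (X.cpx j).C n →+ (X.cpx i).C n :=
  if h : i = j then h ▸ AddMonoidHom.id _ else 0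

@[simp] theorem tr_self (X : DGMod Γ) (i : I) {n : ℤ} (v : (X.cpx i).C n) : X.tr i i v = v := by
  simp [tr]

theorem tr_ne (X : DGMod Γ) {i j : I} (h : i ≠ j) {n : ℤ} (v : (X.cpx j).C n) :
    X.tr i j v = 0 := by
  simp [tr, h]

@[simp] theorem tr_d (X : DGMod Γ) {i j : I} {n : ℤ} (v : (X.cpx j).C n) :
    X.tr i j ((X.cpx j).d v) = (X.cpx i).d (X.tr i j v) := by
  by_cases h : i = j
  · subst h; simp
  · simp [tr_ne _ h]

@[simp] theorem Hom.comm_tr (f : Hom X Y) {i j : I} {n : ℤ} (v : (X.cpx j).C n) :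
    (f.hom i).f (X.tr i j v) = Y.tr i j ((f.hom j).f v) := by
  by_cases h : i = j
  · subst h; simp
  · simp [tr_ne _ h]

/-- The morphism `P_s ⊗ V[2] ⟶ X[2]` corresponding to a chain map from `V` to the complex of `X` at
the vertex `s`. -/
noncomputable abbrev freeLift {s : I} (k : V.Hom (X.cpx s)) : Hom (free Γ s V) X.sh.sh where
  hom i :=
    { f := AddMonoidHom.mk'
        (fun v => X.tr i s (k.f (ev v.1)) + X.x i s (k.f (ev v.2.1)) +
          X.tr i s (X.l s (k.f (ev v.2.2))))
        (fun v w => by simp; abel)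
      comm_d := fun v => by simp only [AddMonoidHom.mk'_apply, map_add, ← tr_d, ← x_d, ← l_d,
        ← k.comm_d, map_ev] }
  comm_x {i j n} v := by
    by_cases hj : j = s
    · subst hj
      by_cases h : Γ.Adj i j
      · simp [ev_pos h]
      · simp [ev_neg h, x_not_adj _ _ h]
    · simp [ev_neg hj, tr_ne _ hj]
      by_cases hi : i = s
      · subst hi
        simp
        by_cases h : Γ.Adj i j
        · simp [x_x _ _ h]
        · have h' : ¬ Γ.Adj j i := fun h' => h h'.symm
          simp [ev_neg h']
      · simp [x_x_ne _ _ hi, tr_ne _ hi]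
  comm_l {i n} v := by
    by_cases hi : i = s
    · subst hi
      simp
    · have h : ∀ {n} (w : (X.cpx s).C n), X.l i (X.x i s w) = 0 := fun w => X.l_x w
      simp [ev_neg hi, h]

/-- The value of `freeLift k` on a generator. -/
theorem freeLift_gen {s : I} (k : V.Hom (X.cpx s)) {n : ℤ} (v : V.C (n + 1 + 1)) :
    ((freeLift k).hom s).f ((fun _ => v, 0, 0) : ((free Γ s V).cpx s).C n) = k.f v := by
  simp

/-- A morphism out of a free module is determined by its values on the generators. -/
theorem free_hom_ext {s : I} {f g : Hom (free Γ s V) Y}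
    (h : ∀ {n} (v : V.C (n + 1 + 1)), (f.hom s).f ((fun _ => v, 0, 0) : ((free Γ s V).cpx s).C n) =
      (g.hom s).f (fun _ => v, 0, 0)) {i : I} {n : ℤ} (v : ((free Γ s V).cpx i).C n) :
    (f.hom i).f v = (g.hom i).f v := by
  -- The degree has to be large enough for the arrow and the loop to act on a generator.
  obtain ⟨m, rfl⟩ : ∃ m, n = m + 1 + 1 := ⟨n - 2, by ring⟩
  obtain ⟨a, b, c⟩ := v
  have ha : (f.hom i).f (a, 0, 0) = (g.hom i).f (a, 0, 0) := by
    by_cases hi : i = s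
    · subst hi
      exact h (a ⟨rfl⟩)
    · have : a = 0 := funext fun h => absurd h.down hi
      subst this
      exact (map_zero (f.hom i).f).trans (map_zero (g.hom i).f).symm
  have hb : (f.hom i).f (0, b, 0) = (g.hom i).f (0, b, 0) := by
    by_cases hi : Γ.Adj i s
    · have : ((0, b, 0) : ((free Γ s V).cpx i).C (m + 1 + 1)) =
          (free Γ s V).x i s (n := m + 1) (fun _ => b ⟨hi⟩, 0, 0) := by
        ext <;> simp
      rw [this, f.comm_x, g.comm_x, h]
    · have : b = 0 := funext fun h => absurd h.down hi
      subst this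
      exact (map_zero (f.hom i).f).trans (map_zero (g.hom i).f).symm
  have hc : (f.hom i).f (0, 0, c) = (g.hom i).f (0, 0, c) := by
    by_cases hi : i = s
    · subst hi
      have : ((0, 0, c) : ((free Γ i V).cpx i).C (m + 1 + 1)) =
          (free Γ i V).l i (n := m) (fun _ => c ⟨rfl⟩, 0, 0) := by
        ext <;> simp
      rw [this, f.comm_l, g.comm_l, h]
    · have : c = 0 := funext fun h => absurd h.down hi
      subst this
      exact (map_zero (f.hom i).f).trans (map_zero (g.hom i).f).symm
  have hv : ((a, b, c) : ((free Γ s V).cpx i).C (m + 1 + 1)) = (a, 0, 0) + ((0, b, 0) + (0, 0, c)) := by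
    ext <;> simp
  rw [hv, map_add, map_add, map_add, map_add, ha, hb, hc]

/-- The functor `free` on chain maps. -/
noncomputable abbrev freeMap (Γ : SimpleGraph I) (s : I) (k : V.Hom W) :
    Hom (free Γ s V) (free Γ s W) where
  hom i :=
    { f := AddMonoidHom.mk'
        (fun v => (fun h => k.f (v.1 h), fun h => k.f (v.2.1 h), fun h => k.f (v.2.2 h)))
        (fun v w => by ext <;> simp)
      comm_d := fun v => by ext <;> simp }
  comm_x v := by ext <;> simp [map_ev]
  comm_l v := by ext <;> simp

theorem freeMap_qis (s : I) {k : V.Hom W} (hk : k.Qis) : (freeMap Γ s k).Qis := by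
  intro i
  constructor
  · intro n v w hv hw
    simp only [AddMonoidHom.mk'_apply, Prod.ext_iff, funext_iff]
      at hv hw
    choose a ha using fun h => hk.inj (v.1 h) (w.1 h) (hv.1 h) (hw.1 h)
    choose b hb using fun h => hk.inj (v.2.1 h) (w.2.1 h) (hv.2.1 h) (hw.2.1 h)
    choose c hc using fun h => hk.inj (v.2.2 h) (w.2.2 h) (hv.2.2 h) (hw.2.2 h)
    exact ⟨(a, b, c), by ext <;> simp [ha, hb, hc]⟩
  · intro n w hw
    simp only [AddMonoidHom.mk'_apply, Prod.mk_eq_zero, funext_iff, Pi.zero_apply] at hw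
    choose a ha a' ha' using fun h => hk.surj (w.1 h) (hw.1 h)
    choose b hb b' hb' using fun h => hk.surj (w.2.1 h) (hw.2.1 h)
    choose c hc c' hc' using fun h => hk.surj (w.2.2 h) (hw.2.2 h)
    exact ⟨(a, b, c), by ext <;> simp [ha, hb, hc], (a', b', c'), by
      ext <;> simp [← ha', ← hb', ← hc']⟩

/-- The counit `P_s ⊗ X_s[2] ⟶ X[2]`. -/
noncomputable abbrev counit (s : I) (X : DGMod Γ) : Hom (free Γ s (X.cpx s)) X.sh.sh :=
  freeLift ⟨AddMonoidHom.id _, fun _ => rfl⟩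

/-- The unit `X ⟶ P_s ⊗ X_s[2]`. -/
noncomputable abbrev unit (s : I) (X : DGMod Γ) : Hom X (free Γ s (X.cpx s)) where
  hom i :=
    { f := AddMonoidHom.mk'
        (fun v => (fun _ => X.l s (X.tr s i v), fun _ => X.x s i v, fun _ => X.tr s i v))
        (fun v w => by ext <;> simp)
      comm_d := fun v => by ext <;> simp }
  comm_x {i j n} v := by
    ext h
    · simp
      obtain ⟨rfl⟩ := h
      simp
    · simp
      by_cases hj : j = s
      · subst hj
        simp [x_x _ _ h.down.symm]
      · have := Ne.symm hj
        simp [ev_neg hj, x_x_ne _ _ this]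
    · obtain ⟨rfl⟩ := h
      simp
      by_cases h : Γ.Adj j i
      · simp [ev_pos h]
      · have h' : ¬ Γ.Adj i j := fun h' => h h'.symm
        simp [ev_neg h, x_not_adj _ _ h']
  comm_l {i n} v := by
    ext h
    · obtain ⟨rfl⟩ := h
      simp
    · simp
    · obtain ⟨rfl⟩ := h
      simp

/-- The spherical twist along the free module at `s`. With the normalization of `free`, it is
shifted by two. -/
noncomputable abbrev twist (s : I) (X : DGMod Γ) : DGMod Γ := cone (counit s X)

/-- The inverse of the spherical twist along the free module at `s`, up to a shift: both composites
with `twist s` are the shift by three. -/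
noncomputable abbrev cotwist (s : I) (X : DGMod Γ) : DGMod Γ := cone (unit s X)

end DGMod

/-! ### Functoriality and invertibility of the twists -/

/-- The identity chain map. -/
abbrev Cpx.Hom.id (V : Cpx) : V.Hom V := ⟨AddMonoidHom.id _, fun _ => rfl⟩

theorem Cpx.Hom.Qis.id (V : Cpx) : (Cpx.Hom.id V).Qis :=
  .of_bijective (fun h => h) (fun v => ⟨v, rfl⟩)

namespace DGMod

variable {X Y : DGMod Γ} {V W : Cpx}

/-- The identity morphism. -/
abbrev Hom.id (X : DGMod Γ) : Hom X X := ⟨fun _ => Cpx.Hom.id _, fun _ => rfl, fun _ => rfl⟩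

theorem Hom.Qis.id (X : DGMod Γ) : (Hom.id X).Qis := fun _ => Cpx.Hom.Qis.id _

/-- The functor `twist s` on morphisms. -/
noncomputable abbrev twistMap (s : I) (f : Hom X Y) : Hom (twist s X) (twist s Y) :=
  coneMap f.sh.sh (freeMap Γ s (f.hom s)) (fun i n v => by simp [map_ev])

theorem twistMap_qis (s : I) {f : Hom X Y} (hf : f.Qis) : (twistMap s f).Qis :=
  coneMap_qis _ hf.sh.sh (freeMap_qis s (hf s))

/-- The functor `cotwist s` on morphisms. -/
noncomputable abbrev cotwistMap (s : I) (f : Hom X Y) : Hom (cotwist s X) (cotwist s Y) :=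
  coneMap (freeMap Γ s (f.hom s)) f (fun i n v => by ext <;> simp)

theorem cotwistMap_qis (s : I) {f : Hom X Y} (hf : f.Qis) : (cotwistMap s f).Qis :=
  coneMap_qis _ (freeMap_qis s (hf s)) hf

/-- The complex at `s` of the twist of `X` at `s` is, up to a shift, that of `X`. -/
noncomputable abbrev twistProj (s : I) (X : DGMod Γ) : ((twist s X).cpx s).Hom (X.cpx s).sh where
  f := AddMonoidHom.mk' (fun v => v.2.2.2 ⟨rfl⟩) (fun v w => by simp)
  comm_d v := by simp

theorem twistProj_qis (s : I) (X : DGMod Γ) : (twistProj s X).Qis := by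
  constructor
  · rintro n ⟨u, a, b, c⟩ w hv hw
    simp only [AddMonoidHom.mk'_apply, Prod.mk_eq_zero, funext_iff, ev_self, ev_adj_self, map_zero,
      tr_self, add_zero, AddMonoidHom.id_apply] at hv hw
    refine ⟨(0, fun _ => u + X.l s w, 0, fun _ => w), ?_⟩
    have := (X.cpx s).eq_of_add_eq_zero hv.1
    ext h
    · simp [add_assoc]
    · simp [← X.l_d, ← hw, this, add_assoc]
    · exact absurd h.down Γ.irrefl
    · simp [← hw]
  · intro n w hw
    have hw' : (X.cpx s).d w = 0 := hw
    refine ⟨(0, fun _ => X.l s w, 0, fun _ => w), ?_, 0, by simp⟩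
    ext h
    · simp
    · simp [← X.l_d, hw']
    · exact absurd h.down Γ.irrefl
    · simp [hw']

/-- The comparison `cotwist (twist X) ⟶ cone (twist X ⟶ P_s ⊗ X_s[3])`. The target is a shift of `X`
by `inrConeSnd_qis`. -/
noncomputable abbrev cotwistTwist (s : I) (X : DGMod Γ) :
    Hom (cotwist s (twist s X)) (cone (coneSnd (counit s X))) :=
  coneMap (freeMap Γ s (twistProj s X)) (Hom.id _) (fun i n v => by
    ext h
    · obtain ⟨rfl⟩ := h
      simpa using congrArg (fun w => w.2.1 ⟨rfl⟩) (tr_self (twist i X) i v)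
    · simp [ev_pos h.down]
    · obtain ⟨rfl⟩ := h
      exact congrArg (fun w => w.2.2.2 ⟨rfl⟩) (tr_self (twist i X) i v))

theorem cotwistTwist_qis (s : I) (X : DGMod Γ) : (cotwistTwist s X).Qis :=
  coneMap_qis _ (freeMap_qis s (twistProj_qis s X)) (Hom.Qis.id _)

/-- The inclusion of the generators of `P_s ⊗ X_s[2]` into the cotwist of `X` at `s`. -/
noncomputable abbrev cotwistGen (s : I) (X : DGMod Γ) :
    (X.cpx s).sh.sh.Hom ((cotwist s X).cpx s) where
  f := AddMonoidHom.mk' (fun v => ((fun _ => v, 0, 0), 0)) (fun v w => by ext <;> simp)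
  comm_d v := by ext <;> simp

theorem cotwistGen_qis (s : I) (X : DGMod Γ) : (cotwistGen s X).Qis := by
  constructor
  · rintro n v ⟨⟨a, b, c⟩, u⟩ hv hw
    simp only [AddMonoidHom.mk'_apply, Prod.mk.injEq, funext_iff, Prod.mk_add_mk, tr_self] at hw
    obtain ⟨⟨h1, -, h3⟩, h4⟩ := hw
    refine ⟨a ⟨rfl⟩ + X.l s (c ⟨rfl⟩), ?_⟩
    have h1 := h1 ⟨rfl⟩
    have h3 := (X.cpx s).eq_of_add_eq_zero (h3 ⟨rfl⟩).symm
    simp [h1, ← h3]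
  · rintro n ⟨⟨a, b, c⟩, u⟩ hw
    simp only [AddMonoidHom.mk'_apply, Prod.mk_eq_zero, funext_iff, Prod.mk_add_mk, tr_self] at hw
    obtain ⟨⟨h1, -, h3⟩, h4⟩ := hw
    have h1 := h1 ⟨rfl⟩
    have h3 : (X.cpx s).d (c ⟨rfl⟩) = u := (X.cpx s).eq_of_add_eq_zero (h3 ⟨rfl⟩)
    refine ⟨a ⟨rfl⟩ + X.l s (c ⟨rfl⟩), ?_, (0, c ⟨rfl⟩), ?_⟩
    · simp at h1 ⊢
      rw [← h1, ← h3]; simp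
    · ext h
      · simp [add_assoc]
      · exact absurd h.down Γ.irrefl
      · simp
      · simp [h3]

theorem counit_freeMap {s : I} (k : V.Hom (X.cpx s)) {i : I} {n : ℤ}
    (v : ((free Γ s V).cpx i).C n) :
    ((counit s X).hom i).f (((freeMap Γ s k).hom i).f v) = ((freeLift k).hom i).f v := by
  simp [map_ev]

theorem coneInl_unit (s : I) (X : DGMod Γ) (i : I) {n : ℤ}
    (v : ((free Γ s (X.cpx s).sh.sh).cpx i).C n) :
    (((coneInl (unit s X)).sh.sh.hom i).f v : ((cotwist s X).cpx i).C (n + 1 + 1)) =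
      ((freeLift (cotwistGen s X)).hom i).f v := by
  refine free_hom_ext (Y := (cotwist s X).sh.sh) (f := (coneInl (unit s X)).sh.sh)
    (g := freeLift (cotwistGen s X)) (fun {n} v => ?_) v
  rw [freeLift_gen]
  rfl

/-- The comparison `cone (P_s ⊗ X_s[4] ⟶ cotwist X [2]) ⟶ twist (cotwist X)`. The source is a shift
of `X` by `coneConeInl_qis`. -/
noncomputable abbrev twistCotwist (s : I) (X : DGMod Γ) :
    Hom (cone (coneInl (unit s X)).sh.sh) (twist s (cotwist s X)) :=
  coneMap (Hom.id _) (freeMap Γ s (cotwistGen s X)) (fun i n v => by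
    rw [counit_freeMap]
    exact coneInl_unit s X i v)

theorem twistCotwist_qis (s : I) (X : DGMod Γ) : (twistCotwist s X).Qis :=
  coneMap_qis _ (Hom.Qis.id _) (freeMap_qis s (cotwistGen_qis s X))

end DGMod

/-! ### Modules up to quasi-isomorphism -/

/-- Transport between cochains of equal degrees. -/
def Cpx.cast (V : Cpx) {m n : ℤ} (h : m = n) : V.C m →+ V.C n := h ▸ AddMonoidHom.id _

@[simp] theorem Cpx.cast_cast (V : Cpx) {k m n : ℤ} (h : k = m) (h' : m = n) (v : V.C k) :
    V.cast h' (V.cast h v) = V.cast (h.trans h') v := by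
  subst h; subst h'; rfl

theorem Cpx.sh_cast (V : Cpx) {m n : ℤ} (h : m = n) (v : V.sh.C m) :
    V.sh.cast h v = V.cast (by rw [h]) v := by
  subst h; rfl

theorem Cpx.Hom.Qis.of_sh {V W : Cpx} {f : V.Hom W} (hf : f.sh.Qis) : f.Qis := by
  constructor
  · intro n v w
    obtain ⟨m, rfl⟩ : ∃ m, n = m + 1 := ⟨n - 1, by ring⟩
    exact hf.inj v w
  · intro n w
    obtain ⟨m, rfl⟩ : ∃ m, n = m + 1 := ⟨n - 1, by ring⟩
    exact hf.surj w

theorem Cpx.Hom.Qis.of_comp_right {U V W : Cpx} {g : V.Hom W} {f : U.Hom V} (hgf : (g.comp f).Qis)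
    (hf : f.Qis) : g.Qis where
  inj v w hv h := by
    obtain ⟨u, hu, v', rfl⟩ := hf.surj v hv
    obtain ⟨u', rfl⟩ := hgf.inj u (w + g.f v') hu (by
      rw [map_add, ← h, map_add, g.comm_d, add_assoc, W.add_self, add_zero]; rfl)
    exact ⟨f.f u' + v', by simp⟩
  surj w hw := by
    obtain ⟨u, hu, w', h⟩ := hgf.surj w hw
    exact ⟨f.f u, by rw [← f.comm_d, hu, map_zero], w', h⟩

namespace DGMod

variable {X Y : DGMod Γ}

theorem d_cast (X : DGMod Γ) {i : I} {m n : ℤ} (h : m = n)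
    (v : (X.cpx i).C m) : (X.cpx i).d ((X.cpx i).cast h v) =
      (X.cpx i).cast (by rw [h]) ((X.cpx i).d v) := by
  subst h; rfl

theorem x_cast (X : DGMod Γ) {i j : I} {m n : ℤ} (h : m = n)
    (v : (X.cpx j).C m) : X.x i j ((X.cpx j).cast h v) =
      (X.cpx i).cast (by rw [h]) (X.x i j v) := by
  subst h; rfl

theorem l_cast (X : DGMod Γ) {i : I} {m n : ℤ} (h : m = n)
    (v : (X.cpx i).C m) : X.l i ((X.cpx i).cast h v) =
      (X.cpx i).cast (by rw [h]) (X.l i v) := by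
  subst h; rfl

/-- The inverse shift `X[-1]`. -/
abbrev unsh (X : DGMod Γ) : DGMod Γ where
  cpx i :=
    { C := fun n => (X.cpx i).C (n - 1)
      add_self := fun v => (X.cpx i).add_self v
      d := ((X.cpx i).cast (by ring)).comp (X.cpx i).d
      d_d := fun v => by simp [d_cast] }
  x i j n := ((X.cpx i).cast (by ring)).comp (X.x i j)
  l i n := ((X.cpx i).cast (by ring)).comp (X.l i)
  x_d v := by simp [d_cast, x_cast]
  l_d v := by simp [d_cast, l_cast]
  x_not_adj v h := by simp [x_not_adj _ _ h]
  x_x v h := by simp [x_cast, x_x _ _ h]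
  x_x_ne v h := by simp [x_cast, x_x_ne _ _ h]
  x_l v := by simp [x_cast]
  l_x v := by simp [l_cast]
  l_l v := by simp [l_cast]

theorem Hom.comm_cast (f : Hom X Y) {i : I} {m n : ℤ} (h : m = n) (v : (X.cpx i).C m) :
    (f.hom i).f ((X.cpx i).cast h v) = (Y.cpx i).cast h ((f.hom i).f v) := by
  subst h; rfl

/-- The functor `unsh` on morphisms. -/
abbrev Hom.unsh (f : Hom X Y) : Hom X.unsh Y.unsh where
  hom i :=
    { f := fun {n} => (f.hom i).f (n := n - 1)
      comm_d := fun v => by simp [comm_cast] }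
  comm_x v := by simp [comm_cast]
  comm_l v := by simp [comm_cast]

/-- The unit of the equivalence between `sh` and `unsh`. -/
abbrev shUnsh (X : DGMod Γ) : Hom X X.unsh.sh where
  hom i :=
    { f := fun {n} => (X.cpx i).cast (by ring)
      comm_d := fun v => by simp [d_cast] }
  comm_x v := by simp [x_cast]
  comm_l v := by simp [l_cast]

/-- The counit of the equivalence between `sh` and `unsh`. -/
abbrev unshSh (X : DGMod Γ) : Hom X X.sh.unsh where
  hom i :=
    { f := fun {n} => (X.cpx i).cast (by ring)
      comm_d := fun v => by
        change _ = (X.cpx i).sh.cast _ ((X.cpx i).d ((X.cpx i).cast _ v))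
        rw [Cpx.sh_cast]
        simp [d_cast] }
  comm_x {i j n} v := by
    change _ = (X.cpx i).sh.cast _ (X.x i j ((X.cpx j).cast _ v))
    rw [Cpx.sh_cast]
    simp [x_cast]
  comm_l {i n} v := by
    change _ = (X.cpx i).sh.cast _ (X.l i ((X.cpx i).cast _ v))
    rw [Cpx.sh_cast]
    simp [l_cast]

theorem _root_.Zigzag.Cpx.cast_bijective (V : Cpx) {m n : ℤ} (h : m = n) :
    Function.Bijective (V.cast h) := by
  subst h; exact Function.bijective_id

theorem shUnsh_qis (X : DGMod Γ) : X.shUnsh.Qis := fun i =>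
  .of_bijective (@fun n => ((X.cpx i).cast_bijective (n := n + 1 - 1) (by ring)).1)
    (@fun n => ((X.cpx i).cast_bijective (n := n + 1 - 1) (by ring)).2)

theorem Hom.Qis.unsh {f : Hom X Y} (hf : f.Qis) : f.unsh.Qis := by
  intro i
  have h : (((f.unsh.sh).comp (shUnsh X)).hom i).Qis := by
    have : ((f.unsh.sh).comp (shUnsh X)).hom i = ((shUnsh Y).comp f).hom i := by
      simp only [Cpx.Hom.mk.injEq]
      ext n v
      simp [comm_cast]
    rw [this]
    exact ((shUnsh_qis Y).comp hf) i
  exact .of_sh (.of_comp_right h (shUnsh_qis X i))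

theorem unshSh_qis (X : DGMod Γ) : X.unshSh.Qis := fun i =>
  .of_bijective (@fun n => ((X.cpx i).cast_bijective (n := n - 1 + 1) (by ring)).1)
    (@fun n => ((X.cpx i).cast_bijective (n := n - 1 + 1) (by ring)).2)

/-- Two modules are related if there is a quasi-isomorphism from the first to the second. -/
def QisRel (X Y : DGMod Γ) : Prop := ∃ f : Hom X Y, f.Qis

end DGMod

variable (Γ) in
/-- The set of differential graded modules up to zigzags of quasi-isomorphisms. -/
def DerivedClass : Type (max u 1) := Quot (DGMod.QisRel (Γ := Γ))

namespace DGMod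

variable {X Y : DGMod Γ}

/-- The class of a differential graded module. -/
def cls (X : DGMod Γ) : DerivedClass Γ := Quot.mk _ X

theorem cls_eq {f : Hom X Y} (hf : f.Qis) : cls X = cls Y := Quot.sound ⟨f, hf⟩

end DGMod

namespace DerivedClass

open DGMod

/-- The shift on classes of modules. -/
def sh : DerivedClass Γ → DerivedClass Γ :=
  Quot.map DGMod.sh fun _ _ ⟨f, hf⟩ => ⟨f.sh, hf.sh⟩

/-- The inverse shift on classes of modules. -/
def unsh : DerivedClass Γ → DerivedClass Γ :=
  Quot.map DGMod.unsh fun _ _ ⟨f, hf⟩ => ⟨f.unsh, hf.unsh⟩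

/-- The twist on classes of modules. -/
noncomputable def twist (s : I) : DerivedClass Γ → DerivedClass Γ :=
  Quot.map (DGMod.twist s) fun _ _ ⟨f, hf⟩ => ⟨twistMap s f, twistMap_qis s hf⟩

/-- The inverse twist on classes of modules, up to a shift. -/
noncomputable def cotwist (s : I) : DerivedClass Γ → DerivedClass Γ :=
  Quot.map (DGMod.cotwist s) fun _ _ ⟨f, hf⟩ => ⟨cotwistMap s f, cotwistMap_qis s hf⟩

theorem sh_bijective : Function.Bijective (sh (Γ := Γ)) := by
  refine Function.bijective_iff_has_inverse.2 ⟨unsh, ?_, ?_⟩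
  · rintro ⟨X⟩
    exact (cls_eq (unshSh_qis X)).symm
  · rintro ⟨X⟩
    exact (cls_eq (shUnsh_qis X)).symm

theorem cotwist_twist (s : I) (X : DerivedClass Γ) :
    cotwist s (twist s X) = sh (sh (sh X)) := by
  obtain ⟨X⟩ := X
  exact (cls_eq (cotwistTwist_qis s X)).trans (cls_eq (inrConeSnd_qis (counit s X))).symm

theorem twist_cotwist (s : I) (X : DerivedClass Γ) :
    twist s (cotwist s X) = sh (sh (sh X)) := by
  obtain ⟨X⟩ := X
  exact (cls_eq (twistCotwist_qis s X)).symm.trans (cls_eq (coneConeInl_qis (unit s X)).sh.sh)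

theorem twist_bijective (s : I) : Function.Bijective (twist (Γ := Γ) s) := by
  have h := (sh_bijective (Γ := Γ)).comp (sh_bijective.comp sh_bijective)
  constructor
  · refine Function.Injective.of_comp (f := cotwist s) ?_
    rw [show cotwist s ∘ twist s = _ from funext fun X => cotwist_twist (Γ := Γ) s X]
    exact h.1
  · refine Function.Surjective.of_comp (g := cotwist s) ?_
    rw [show twist s ∘ cotwist s = _ from funext fun X => twist_cotwist (Γ := Γ) s X]
    exact h.2

end DerivedClass

/-! ### Twists of cones and of adjacent vertices -/

namespace DGMod

variable {X Y E : DGMod Γ} {V W : Cpx}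

theorem Hom.Qis.congr {f g : Hom X Y} (hf : f.Qis)
    (h : ∀ i {n} (v : (X.cpx i).C n), (f.hom i).f v = (g.hom i).f v) : g.Qis := fun i =>
  ⟨fun v w hv e => (hf i).inj v w hv ((h i v).trans e), fun w hw => by
    obtain ⟨v, hv, u, e⟩ := (hf i).surj w hw
    exact ⟨v, hv, u, by rw [e, h]⟩⟩

theorem ev_fst {p : Prop} {A B : Type} [AddCommGroup A] [AddCommGroup B] (a : On p (A × B)) :
    (ev a).1 = ev (fun h => (a h).1) := map_ev (AddMonoidHom.fst A B) a

theorem ev_snd {p : Prop} {A B : Type} [AddCommGroup A] [AddCommGroup B] (a : On p (A × B)) :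
    (ev a).2 = ev (fun h => (a h).2) := map_ev (AddMonoidHom.snd A B) a

theorem counit_apply (t i : I) {n : ℤ} (v : ((free Γ t (X.cpx t)).cpx i).C n) :
    ((counit t X).hom i).f v = X.tr i t (ev v.1) + X.x i t (ev v.2.1) + X.tr i t (X.l t (ev v.2.2)) :=
  rfl

theorem counit_self (t : I) {n : ℤ} (v : ((free Γ t (X.cpx t)).cpx t).C n) :
    ((counit t X).hom t).f v = v.1 ⟨rfl⟩ + X.l t (v.2.2 ⟨rfl⟩) := by
  rw [counit_apply, ev_self, ev_self, ev_adj_self, tr_self, tr_self, map_zero, add_zero]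

theorem counit_of_ne {i t : I} (h : i ≠ t) {n : ℤ} (v : ((free Γ t (X.cpx t)).cpx i).C n) :
    ((counit t X).hom i).f v = X.x i t (ev v.2.1) := by
  rw [counit_apply, tr_ne _ h, tr_ne _ h, add_zero, zero_add]

theorem counit_adj {i t : I} (h : Γ.Adj i t) {n : ℤ} (v : ((free Γ t (X.cpx t)).cpx i).C n) :
    ((counit t X).hom i).f v = X.x i t (v.2.1 ⟨h⟩) := by
  rw [counit_of_ne h.ne, ev_pos h]

theorem counit_not_adj {i t : I} (hne : i ≠ t) (h : ¬ Γ.Adj i t) {n : ℤ}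
    (v : ((free Γ t (X.cpx t)).cpx i).C n) : ((counit t X).hom i).f v = 0 := by
  rw [counit_of_ne hne, X.x_not_adj _ h]

theorem counit_cone (t i : I) (f : Hom Y X) {n : ℤ} (v : ((free Γ t ((cone f).cpx t)).cpx i).C n) :
    ((counit t (cone f)).hom i).f v =
      (((counit t X).hom i).f (fun h => (v.1 h).1, fun h => (v.2.1 h).1, fun h => (v.2.2 h).1),
        ((counit t Y).hom i).f (fun h => (v.1 h).2, fun h => (v.2.1 h).2, fun h => (v.2.2 h).2)) := by
  by_cases hi : i = t
  · subst hi
    rw [counit_self, counit_self, counit_self]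
    rfl
  · by_cases h : Γ.Adj i t
    · rw [counit_adj h, counit_adj h, counit_adj h]
      rfl
    · rw [counit_not_adj hi h, counit_not_adj hi h, counit_not_adj hi h]
      rfl

/-- The twist commutes with cones. -/
noncomputable abbrev twistCone (t : I) (f : Hom Y X) :
    Hom (twist t (cone f)) (cone (twistMap t f)) where
  hom i :=
    { f := AddMonoidHom.mk'
        (fun v => ((v.1.1, (fun h => (v.2.1 h).1, fun h => (v.2.2.1 h).1, fun h => (v.2.2.2 h).1)),
          (v.1.2, (fun h => (v.2.1 h).2, fun h => (v.2.2.1 h).2, fun h => (v.2.2.2 h).2))))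
        (fun v w => by ext <;> rfl)
      comm_d := fun v => by
        have h := counit_cone t i f v.2
        refine Prod.ext (Prod.ext ?_ rfl) (Prod.ext ?_ rfl)
        · refine (congrArg (fun z => _ + Prod.fst z) h).trans ?_
          exact add_right_comm _ _ _
        · exact congrArg (fun z => _ + Prod.snd z) h }
  comm_x v := Prod.ext
    (Prod.ext rfl (Prod.ext rfl (Prod.ext (funext fun _ => ev_fst _) (funext fun _ => ev_fst _))))
    (Prod.ext rfl (Prod.ext rfl (Prod.ext (funext fun _ => ev_snd _) (funext fun _ => ev_snd _))))
  comm_l v := rfl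

theorem twistCone_qis (t : I) (f : Hom Y X) : (twistCone t f).Qis := by
  intro i
  refine .of_bijective ?_ ?_
  · intro n v w h
    simp only [AddMonoidHom.mk'_apply, Prod.mk.injEq, funext_iff] at h
    ext
    · exact h.1.1
    · exact h.2.1
    · exact h.1.2.1 _
    · exact h.2.2.1 _
    · exact h.1.2.2.1 _
    · exact h.2.2.2.1 _
    · exact h.1.2.2.2 _
    · exact h.2.2.2.2 _
  · intro n w
    exact ⟨((w.1.1, w.2.1), (fun h => (w.1.2.1 h, w.2.2.1 h), fun h => (w.1.2.2.1 h, w.2.2.2.1 h),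
      fun h => (w.1.2.2.2 h, w.2.2.2.2 h))), rfl⟩

/-- Two models for the twist of `Y` at `s`: the free module on the complex at `s` may be replaced by
a module `E` quasi-isomorphic to it. -/
theorem cls_twist_eq_cls_cone {s : I} {κ : V.Hom (Y.cpx s)} (hκ : κ.Qis) {θ : Hom (free Γ s V) E}
    (hθ : θ.Qis) {p : Hom E Y.sh.sh}
    (h : ∀ {n} (v : V.C (n + 1 + 1)), (p.hom s).f ((θ.hom s).f (fun _ => v, 0, 0)) = κ.f v) :
    cls (twist s Y) = cls (cone p) := by
  have h₁ : (coneMap (f := freeLift κ) (f' := counit s Y) (Hom.id _) (freeMap Γ s κ)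
      (fun i n v => (counit_freeMap κ v).symm)).Qis :=
    coneMap_qis _ (Hom.Qis.id _) (freeMap_qis s hκ)
  have h₂ : (coneMap (f := freeLift κ) (f' := p) (Hom.id _) θ
      (fun i n v => free_hom_ext (f := freeLift κ) (g := p.comp θ)
        (fun v => (freeLift_gen κ v).trans (h v).symm) v)).Qis :=
    coneMap_qis _ (Hom.Qis.id _) hθ
  exact (cls_eq h₁).symm.trans (cls_eq h₂)

/-- Twists at non-adjacent vertices commute: the twist at `t` changes neither the complex at `s` nor
the free module at `s`, up to a shift. -/
theorem twist_comm {s t : I} (hne : s ≠ t) (h : ¬ Γ.Adj s t) (X : DGMod Γ) :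
    cls (twist s (twist t X)) = cls (twist t (twist s X)) := by
  have h' : ¬ Γ.Adj t s := fun e => h e.symm
  rw [cls_eq (twistCone_qis t (counit s X))]
  refine cls_twist_eq_cls_cone (κ := (coneInl (counit t X)).hom s)
    (θ := coneInl (counit t (free Γ s (X.cpx s)))) ?_ ?_ ?_
  · refine .of_bijective (fun h => ?_) (fun w => ⟨w.1, ?_⟩)
    · simpa using h
    · ext e
      · simp
      · exact absurd e.down hne
      · exact absurd e.down h
      · exact absurd e.down hne
  · refine fun i => .of_bijective (fun h => ?_) (fun w => ⟨w.1, ?_⟩)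
    · simpa using h
    · have : ∀ m (v : ((free Γ s (X.cpx s)).cpx t).C m), v = 0 := fun m v => by
        ext e
        · exact absurd e.down.symm hne
        · exact absurd e.down h'
        · exact absurd e.down.symm hne
      refine Prod.ext rfl (Prod.ext (funext fun e => ?_) (Prod.ext (funext fun e => ?_)
        (funext fun e => ?_)))
      · exact (this _ _).symm
      · exact (this _ _).symm
      · exact (this _ _).symm
  · intro n v
    ext <;> simp

/-- For adjacent `s` and `t`, the comparison between the complex of `X` at `t` and the complex at `s`
of the iterated twist of `X`. It is a quasi-isomorphism by `braidGen_qis`. -/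
noncomputable abbrev braidGen {s t : I} (h : Γ.Adj s t) (X : DGMod Γ) :
    (X.cpx t).sh.sh.sh.sh.Hom ((twist t (twist s X)).cpx s) where
  f := AddMonoidHom.mk'
    (fun v => ((0, (fun _ => X.x s t v, 0, 0)), (0, fun _ => (v, 0), 0)))
    (fun v w => Prod.ext
      (Prod.ext (add_zero _).symm (Prod.ext (funext fun _ => map_add _ _ _) (add_zero _).symm))
      (Prod.ext (add_zero _).symm (Prod.ext (funext fun _ => Prod.ext rfl (add_zero _).symm)
        (add_zero _).symm)))
  comm_d {n} v := by
    have e := counit_adj (X := twist s X) h (n := n + 1) (0, fun _ => (v, 0), 0)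
    have e₁ := counit_self (X := X) s (n := n + 1 + 1 + 1) (fun _ => X.x s t v, 0, 0)
    refine Prod.ext (Prod.ext ?_ (Prod.ext ?_ (Prod.ext ?_ ?_))) (Prod.ext ?_ (Prod.ext ?_ ?_))
    · refine Eq.trans ?_ (congrArg₂ (fun y z => ((X.cpx s).d 0 + y) + z) e₁
        (congrArg Prod.fst e)).symm
      change 0 = ((X.cpx s).d 0 + (X.x s t v + X.l s 0)) + X.x s t v
      rw [map_zero, map_zero, zero_add, add_zero, (X.cpx s).add_self]
    · refine Eq.trans ?_ (congrArg (fun z => _ + z.2.1) e).symm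
      exact (funext fun _ => X.x_d v).trans (add_zero _).symm
    · refine Eq.trans ?_ (congrArg (fun z => _ + z.2.2.1) e).symm
      exact funext fun k => absurd k.down Γ.irrefl
    · refine Eq.trans ?_ (congrArg (fun z => _ + z.2.2.2) e).symm
      refine funext fun _ => Eq.trans ?_ (congrArg₂ (· + ·) (map_zero (X.cpx s).d).symm ev_zero.symm)
      exact (add_zero _).symm
    · exact funext fun _ => (map_zero ((twist s X).cpx t).d).symm
    · exact funext fun _ => Prod.ext
        ((add_zero _).symm.trans (congrArg (_ + ·) (map_zero ((counit s X).hom t).f).symm))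
        (map_zero ((free Γ s (X.cpx s)).cpx t).d).symm
    · exact funext fun _ => (map_zero ((twist s X).cpx t).d).symm

/-- A homotopy inverse of `braidGen`. -/
noncomputable abbrev braidRetr {s t : I} (h : Γ.Adj s t) (X : DGMod Γ) :
    ((twist t (twist s X)).cpx s).Hom (X.cpx t).sh.sh.sh.sh where
  f := AddMonoidHom.mk'
    (fun v => (v.2.2.1 ⟨h⟩).1 + X.x t s (v.1.2.2.2 ⟨rfl⟩))
    (fun v w => by simp; abel)
  comm_d {n} v := by
    have e := congrArg (fun z => z.2.2.2 ⟨rfl⟩) (counit_adj (X := twist s X) h v.2)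
    have e' := counit_adj (X := X) h.symm (v.2.2.1 ⟨h⟩).2
    refine (congrArg₂ (fun y z => ((X.cpx t).d (v.2.2.1 ⟨h⟩).1 + y) +
      X.x t s ((X.cpx s).d (v.1.2.2.2 ⟨rfl⟩) + z)) e' (e.trans (ev_pos h.symm _))).trans ?_
    change (X.cpx t).d (v.2.2.1 ⟨h⟩).1 + X.x t s ((v.2.2.1 ⟨h⟩).2.2.1 ⟨h.symm⟩) +
      X.x t s ((X.cpx s).d (v.1.2.2.2 ⟨rfl⟩) + (v.2.2.1 ⟨h⟩).2.2.1 ⟨h.symm⟩) =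
        (X.cpx t).d ((v.2.2.1 ⟨h⟩).1 + X.x t s (v.1.2.2.2 ⟨rfl⟩))
    rw [map_add, map_add, X.x_d]
    refine (add_assoc _ _ _).trans (congrArg _ ?_)
    exact (congrArg _ (add_comm _ _)).trans ((X.cpx t).add_self_add _ _)

theorem braidGen_qis {s t : I} (h : Γ.Adj s t) (X : DGMod Γ) : (braidGen h X).Qis := by
  refine .of_retraction (braidRetr h X) (fun v => ?_) (fun {n} w hw => ?_)
  · change v + X.x t s 0 = v
    rw [map_zero, add_zero]
  refine ⟨((0, (fun _ => w.1.1, 0, 0)), (0, fun _ => (0, (0, fun _ => w.1.2.2.2 ⟨rfl⟩, 0)), 0)), ?_⟩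
  have e := counit_adj (X := twist s X) h w.2
  have hw₁ : (X.cpx s).d w.1.1 + (w.1.2.1 ⟨rfl⟩ + X.l s (w.1.2.2.2 ⟨rfl⟩)) +
      X.x s t (w.2.2.1 ⟨h⟩).1 = 0 := by
    refine Eq.trans ?_ (congrArg (fun z => z.1.1) hw)
    exact congrArg₂ (fun y z => (X.cpx s).d w.1.1 + y + z) (counit_self (X := X) s w.1.2).symm
      (congrArg Prod.fst e).symm
  have hw₂ : (X.cpx s).d (w.1.2.2.2 ⟨rfl⟩) + (w.2.2.1 ⟨h⟩).2.2.1 ⟨h.symm⟩ = 0 := by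
    refine Eq.trans ?_ (congrArg (fun z => z.1.2.2.2 ⟨rfl⟩) hw)
    exact congrArg ((X.cpx s).d (w.1.2.2.2 ⟨rfl⟩) + ·) ((congrArg (fun z => z.2.2.2 ⟨rfl⟩) e).trans
      (ev_pos h.symm _)).symm
  have e₀ := counit_adj (X := twist s X) h (n := n + 1)
    (0, fun _ => (0, (0, fun _ => w.1.2.2.2 ⟨rfl⟩, 0)), 0)
  have e₁ := counit_self (X := X) s (n := n + 1 + 1 + 1) (fun _ => w.1.1, 0, 0)
  have e₂ := counit_adj (X := X) h.symm (n := n + 1 + 1 + 1) (0, fun _ => w.1.2.2.2 ⟨rfl⟩, 0)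
  refine Prod.ext (Prod.ext ?_ (Prod.ext ?_ (Prod.ext ?_ ?_))) (Prod.ext ?_ (Prod.ext ?_ ?_))
  · refine Eq.trans ?_ (congrArg₂ (fun y z => 0 + (((X.cpx s).d 0 + y) + z)) e₁
      (congrArg Prod.fst e₀)).symm
    change w.1.1 = 0 + (((X.cpx s).d 0 + (w.1.1 + X.l s 0)) + X.x s t 0)
    simp only [map_zero, zero_add, add_zero]
  · refine Eq.trans ?_ (congrArg (fun z => _ + (_ + z.2.1)) e₀).symm
    refine funext fun k => ?_
    change w.1.2.1 ⟨rfl⟩ = X.x s t ((w.2.2.1 ⟨h⟩).1 + X.x t s (w.1.2.2.2 ⟨rfl⟩)) +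
      ((X.cpx s).d w.1.1 + 0)
    rw [map_add, X.x_x _ h, add_zero]
    refine (X.cpx s).eq_of_add_eq_zero (Eq.trans ?_ hw₁)
    abel
  · exact funext fun k => absurd k.down Γ.irrefl
  · refine Eq.trans ?_ (congrArg (fun z => _ + (_ + z.2.2.2)) e₀).symm
    refine funext fun k => Eq.trans ?_ (congrArg (fun z => 0 + ((X.cpx s).d 0 + z))
      (ev_pos h.symm _)).symm
    change w.1.2.2.2 ⟨rfl⟩ = 0 + ((X.cpx s).d 0 + w.1.2.2.2 ⟨rfl⟩)
    simp only [map_zero, zero_add]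
  · exact funext fun k => absurd k.down h.ne
  · refine funext fun k => Prod.ext ?_ (Prod.ext ?_ (Prod.ext ?_ ?_))
    · refine Eq.trans ?_ (congrArg (fun z => _ + (_ + z)) e₂).symm
      change (w.2.2.1 ⟨h⟩).1 = ((w.2.2.1 ⟨h⟩).1 + X.x t s (w.1.2.2.2 ⟨rfl⟩)) +
        ((X.cpx t).d 0 + X.x t s (w.1.2.2.2 ⟨rfl⟩))
      rw [map_zero, zero_add]
      exact (((add_assoc _ _ _).trans (congrArg _ ((X.cpx t).add_self _))).trans (add_zero _)).symm
    · exact funext fun k => absurd k.down h.ne.symm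
    · refine funext fun k => ?_
      change (w.2.2.1 ⟨h⟩).2.2.1 ⟨h.symm⟩ = 0 + (X.cpx s).d (w.1.2.2.2 ⟨rfl⟩)
      rw [zero_add]
      exact ((X.cpx s).eq_of_add_eq_zero hw₂).symm
    · exact funext fun k => absurd k.down h.ne.symm
  · exact funext fun k => absurd k.down h.ne

end DGMod

/-! ### The iterated twist of a free module -/

namespace DGMod

variable {X Y E : DGMod Γ} {V W : Cpx}

/-- The inclusion of the generators of a free module. -/
noncomputable abbrev freeGen (Γ : SimpleGraph I) (t : I) (V : Cpx) :
    V.sh.sh.Hom ((free Γ t V).cpx t) where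
  f := AddMonoidHom.mk' (fun v => (fun _ => v, 0, 0))
    (fun _ _ => Prod.ext rfl (Prod.ext (add_zero _).symm (add_zero _).symm))
  comm_d _ := Prod.ext rfl (Prod.ext (funext fun _ => (map_zero V.d).symm)
    (funext fun _ => (map_zero V.d).symm))

/-- The inclusion of the generators of a free module at `t` into its twist at a neighbour of
`t`. -/
noncomputable abbrev twistFreeGen (s t : I) (V : Cpx) :
    V.sh.sh.sh.sh.Hom ((twist s (free Γ t V)).cpx t) :=
  ((coneInl (counit s (free Γ t V))).hom t).comp (freeGen Γ t V).sh.sh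

theorem twistFreeGen_qis {s t : I} (h : Γ.Adj s t) (V : Cpx) :
    (twistFreeGen (Γ := Γ) s t V).Qis := by
  let r : ((twist s (free Γ t V)).cpx t).Hom V.sh.sh.sh.sh :=
    { f := AddMonoidHom.mk' (fun w => w.1.1 ⟨rfl⟩) (fun v w => rfl)
      comm_d := fun {n} v => by
        refine (congrArg (fun z => V.d (v.1.1 ⟨rfl⟩) + z.1 ⟨rfl⟩) (counit_adj h.symm v.2)).trans ?_
        exact add_zero _ }
  refine .of_retraction r (fun v => rfl) (fun {n} w hw => ?_)
  refine ⟨(0, (0, fun _ => (0, fun _ => w.1.2.2 ⟨rfl⟩, 0), 0)), ?_⟩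
  have e := counit_adj (X := free Γ t V) h.symm (n := n + 1)
    (0, fun _ => (0, fun _ => w.1.2.2 ⟨rfl⟩, 0), 0)
  have hw₁ : V.d (w.1.2.2 ⟨rfl⟩) + (w.2.2.1 ⟨h.symm⟩).2.1 ⟨h⟩ = 0 := by
    refine Eq.trans ?_ (congrArg (fun z => z.1.2.2 ⟨rfl⟩) hw)
    exact congrArg (V.d (w.1.2.2 ⟨rfl⟩) + ·)
      ((congrArg (fun z => z.2.2 ⟨rfl⟩) (counit_adj h.symm w.2)).trans (ev_pos h _)).symm
  refine Prod.ext (Prod.ext ?_ (Prod.ext ?_ ?_)) (Prod.ext ?_ (Prod.ext ?_ ?_))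
  · refine Eq.trans ?_ (congrArg (fun z => _ + (_ + z.1)) e).symm
    refine funext fun _ => ?_
    change w.1.1 ⟨rfl⟩ = w.1.1 ⟨rfl⟩ + (V.d 0 + 0)
    simp only [map_zero, add_zero]
  · exact funext fun k => absurd k.down Γ.irrefl
  · refine Eq.trans ?_ (congrArg (fun z => _ + (_ + z.2.2)) e).symm
    refine funext fun _ => Eq.trans ?_ (congrArg (fun z => 0 + (V.d 0 + z)) (ev_pos h _)).symm
    change w.1.2.2 ⟨rfl⟩ = 0 + (V.d 0 + w.1.2.2 ⟨rfl⟩)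
    simp only [map_zero, zero_add]
  · exact funext fun k => absurd k.down h.ne.symm
  · refine funext fun k => Prod.ext ?_ (Prod.ext ?_ ?_)
    · exact funext fun k => absurd k.down h.ne
    · refine funext fun _ => ?_
      change (w.2.2.1 ⟨h.symm⟩).2.1 ⟨h⟩ = 0 + V.d (w.1.2.2 ⟨rfl⟩)
      rw [zero_add]
      exact (V.eq_of_add_eq_zero hw₁).symm
    · exact funext fun k => absurd k.down h.ne
  · exact funext fun k => absurd k.down h.ne.symm

/-- The comparison between the cone of the inclusion of `free Γ t V` into its twist at `s`, and the
iterated twist of `free Γ t V`. By `coneConeInl_qis`, the cone is a free module at `s`, up to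
quasi-isomorphism. -/
noncomputable abbrev twistTwistFree (s t : I) (V : Cpx) :
    Hom (cone (coneInl (counit s (free Γ t V))).sh.sh) (twist t (twist s (free Γ t V))) :=
  coneMap (Hom.id _) (freeMap Γ t (twistFreeGen s t V)) (fun i n v => by
    rw [counit_freeMap]
    refine free_hom_ext (Y := (twist s (free Γ t V)).sh.sh)
      (f := (coneInl (counit s (free Γ t V))).sh.sh) (g := freeLift (twistFreeGen s t V))
      (V := V.sh.sh.sh.sh) (fun {n} v => ?_) v
    exact (freeLift_gen (twistFreeGen s t V) v).symm)

theorem twistTwistFree_qis {s t : I} (h : Γ.Adj s t) (V : Cpx) :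
    (twistTwistFree (Γ := Γ) s t V).Qis :=
  coneMap_qis _ (Hom.Qis.id _) (freeMap_qis t (twistFreeGen_qis h V))

/-- The comparison between a complex and the complex of its free module at a neighbour `s` of `t`. -/
noncomputable abbrev freeNbr (Γ : SimpleGraph I) (s t : I) (V : Cpx) :
    V.sh.Hom ((free Γ t V).cpx s) where
  f := AddMonoidHom.mk' (fun v => (0, fun _ => v, 0))
    (fun _ _ => Prod.ext (add_zero _).symm (Prod.ext rfl (add_zero _).symm))
  comm_d _ := Prod.ext (funext fun _ => (map_zero V.d).symm) (Prod.ext rfl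
    (funext fun _ => (map_zero V.d).symm))

theorem freeNbr_qis {s t : I} (h : Γ.Adj s t) (V : Cpx) : (freeNbr Γ s t V).Qis := by
  refine .of_bijective (fun e => congrArg (fun z => z.2.1 ⟨h⟩) e) (fun w => ⟨w.2.1 ⟨h⟩, ?_⟩)
  exact Prod.ext (funext fun k => absurd k.down h.ne)
    (Prod.ext rfl (funext fun k => absurd k.down h.ne))

/-- The inclusion of the generators of a free module at `s` into the source of `twistTwistFree`. -/
noncomputable abbrev coneGen (s t : I) (V : Cpx) : V.sh.sh.sh.sh.sh.sh.Hom
    ((cone (coneInl (counit s (free Γ t V))).sh.sh).cpx s) where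
  f := AddMonoidHom.mk'
    (fun v => ((0, (fun _ => (freeNbr Γ s t V).f v, 0, 0)), (freeNbr Γ s t V).f v))
    (fun v w => Prod.ext (Prod.ext (add_zero _).symm (Prod.ext (funext fun _ => map_add _ _ _)
      (Prod.ext (add_zero _).symm (add_zero _).symm))) (map_add _ _ _))
  comm_d {n} v := by
    have e := counit_self (X := free Γ t V) s (n := n + 1 + 1 + 1)
      (fun _ => (freeNbr Γ s t V).f v, 0, 0)
    refine Prod.ext (Prod.ext ?_ (Prod.ext ?_ (Prod.ext ?_ ?_))) ((freeNbr Γ s t V).comm_d v)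
    · refine Eq.trans ?_ (congrArg (fun z => (_ + z) + _) e).symm
      change 0 = (((free Γ t V).cpx s).d 0 + ((freeNbr Γ s t V).f v + (free Γ t V).l s 0)) +
        (freeNbr Γ s t V).f v
      rw [map_zero, map_zero, zero_add, add_zero, ((free Γ t V).cpx s).add_self]
    · exact (funext fun _ => (freeNbr Γ s t V).comm_d v).trans (add_zero _).symm
    · exact (funext fun _ => (map_zero _).symm).trans (add_zero _).symm
    · exact (funext fun _ => (map_zero _).symm).trans (add_zero _).symm

theorem freeLift_coneGen_qis {s t : I} (h : Γ.Adj s t) (V : Cpx) :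
    (freeLift (coneGen (Γ := Γ) s t V)).Qis := by
  refine Hom.Qis.of_comp (Z := (free Γ s ((free Γ t V).cpx s)).sh.sh.sh.sh.sh)
    (g := (coneConeInl (counit s (free Γ t V))).sh.sh.sh.sh)
    (coneConeInl_qis (counit s (free Γ t V))).sh.sh.sh.sh ?_
  refine (freeMap_qis (Γ := Γ) s (freeNbr_qis h V).sh.sh.sh.sh.sh).congr (fun i n v => ?_)
  refine free_hom_ext (V := V.sh.sh.sh.sh.sh.sh)
    (Y := (free Γ s ((free Γ t V).cpx s)).sh.sh.sh.sh.sh)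
    (f := freeMap Γ s (freeNbr Γ s t V).sh.sh.sh.sh.sh)
    (g := ((coneConeInl (counit s (free Γ t V))).sh.sh.sh.sh).comp
      (freeLift (coneGen (Γ := Γ) s t V))) (fun {n} v => ?_) v
  refine Eq.trans ?_ (congrArg (fun z => z.1.2) (freeLift_gen (coneGen s t V) v)).symm
  rfl

end DGMod

/-! ### The braid relation for twists -/

namespace DGMod

variable {X Y E : DGMod Γ} {V W : Cpx}

/-- The comparison between a free module at `s` and the iterated twist of a free module at a
neighbour `t` of `s`. It corresponds to the map `braidGen` on the generators. -/
noncomputable abbrev braidFree {s t : I} (h : Γ.Adj s t) (V : Cpx) :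
    Hom (free Γ s V.sh.sh.sh.sh.sh.sh) (twist t (twist s (free Γ t V))).sh.sh :=
  freeLift ((braidGen h (free Γ t V)).comp (freeGen Γ t V).sh.sh.sh.sh)

/-- The map `braidFree` factors through the source of `twistTwistFree`, by its values on the
generators. -/
theorem braidFree_qis {s t : I} (h : Γ.Adj s t) (V : Cpx) : (braidFree h V).Qis := by
  refine ((twistTwistFree_qis h V).sh.sh.comp (freeLift_coneGen_qis h V)).congr (fun i n v => ?_)
  refine free_hom_ext (V := V.sh.sh.sh.sh.sh.sh) (Y := (twist t (twist s (free Γ t V))).sh.sh)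
    (f := ((twistTwistFree s t V).sh.sh).comp (freeLift (coneGen s t V))) (g := braidFree h V)
    (fun {n} v => ?_) v
  refine (congrArg (fun z => ((twistTwistFree s t V).hom s).f z)
    (freeLift_gen (coneGen s t V) v)).trans (Eq.trans ?_ (freeLift_gen _ v).symm)
  refine Prod.ext (Prod.ext rfl (Prod.ext ?_ rfl)) (Prod.ext ?_ (Prod.ext rfl ?_))
  · exact funext fun _ => Prod.ext rfl (Prod.ext (funext fun _ => (ev_self (i := t) (fun _ => v)).symm)
      (funext fun k => absurd k.down h.ne))
  · exact funext fun k => absurd k.down h.ne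
  · exact funext fun k => absurd k.down h.ne

theorem braidGen_naturality {s t : I} (h : Γ.Adj s t) (f : Hom X Y) {n : ℤ}
    (v : (X.cpx t).C (n + 1 + 1 + 1 + 1)) :
    ((twistMap t (twistMap s f)).hom s).f ((braidGen h X).f v) =
      (braidGen h Y).f ((f.hom t).f v) := by
  refine Prod.ext (Prod.ext (map_zero _) (Prod.ext (funext fun _ => f.comm_x v) (Prod.ext ?_ ?_)))
    (Prod.ext ?_ (Prod.ext (funext fun _ => Prod.ext rfl ?_) ?_))
  · exact funext fun _ => map_zero _
  · exact funext fun _ => map_zero _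
  · exact funext fun _ => map_zero _
  · exact map_zero ((freeMap Γ s (f.hom s)).hom t).f
  · exact funext fun _ => map_zero _

theorem twist_sh (s : I) (X : DGMod Γ) : twist s X.sh = (twist s X).sh := rfl

theorem cls_twist_twist_cone (s t : I) (f : Hom Y X) :
    cls (twist t (twist s (cone f))) = cls (cone (twistMap t (twistMap s f))) :=
  (cls_eq (twistMap_qis t (twistCone_qis s f))).trans (cls_eq (twistCone_qis t (twistMap s f)))

/-- The maps `braidFree` and `braidGen` are compatible with the counit. -/
theorem braidFree_gen {s t : I} (h : Γ.Adj s t) (X : DGMod Γ) {n : ℤ}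
    (v : (X.cpx t).sh.sh.sh.sh.sh.sh.C (n + 1 + 1)) :
    ((twistMap t (twistMap s (counit t X))).hom s).f
      (((braidFree h (X.cpx t)).hom s).f ((fun _ => v, 0, 0) :
        ((free Γ s (X.cpx t).sh.sh.sh.sh.sh.sh).cpx s).C n)) = (braidGen h X.sh.sh).f v := by
  refine (congrArg (fun z => ((twistMap t (twistMap s (counit t X))).hom s).f z)
    (freeLift_gen _ v)).trans ?_
  refine (braidGen_naturality h (counit t X) (n := n + 1 + 1) _).trans ?_
  refine congrArg (braidGen h X.sh.sh).f (a₁ := ((counit t X).hom t).f (fun _ => v, 0, 0)) ?_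
  exact freeLift_gen (⟨AddMonoidHom.id _, fun _ => rfl⟩ : (X.cpx t).Hom (X.cpx t)) v

theorem cls_twist_twist_sh_sh {s t : I} (h : Γ.Adj s t) (X : DGMod Γ) :
    cls (twist s (twist t (twist s X.sh.sh))) =
      cls (cone (twistMap t (twistMap s (counit t X))).sh.sh) :=
  cls_twist_eq_cls_cone (κ := braidGen h X.sh.sh) (braidGen_qis h X.sh.sh)
    (braidFree_qis h (X.cpx t)) (braidFree_gen h X)

/-- The iterated twist of the cone of `counit t X` is a cone with the same source and target, up to
quasi-isomorphism, as the twist at `s` of the iterated twist of `X`. -/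
theorem twist_braid {s t : I} (h : Γ.Adj s t) (X : DGMod Γ) :
    cls (twist s (twist t (twist s X))) = cls (twist t (twist s (twist t X))) := by
  rw [cls_twist_twist_cone s t (counit t X)]
  refine DerivedClass.sh_bijective.1 (DerivedClass.sh_bijective.1 ?_)
  have e : cls (twist s (twist t (twist s X.sh.sh))) =
      (cls (twist s (twist t (twist s X)))).sh.sh := by
    rw [twist_sh, twist_sh, twist_sh, twist_sh, twist_sh, twist_sh]
    rfl
  exact e.symm.trans (cls_twist_twist_sh_sh h X)

end DGMod

/-! ### Vanishing of cohomology in lowest degree -/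

namespace DGMod

/-- The cohomology of the complex at `s` of the twist at `s`. -/
theorem van_twist_self (s : I) (X : DGMod Γ) (n : ℤ) :
    ((twist s X).cpx s).Van n ↔ (X.cpx s).Van (n + 1) :=
  (twistProj_qis s X).van_iff n

theorem van_twist_of_ne {i s : I} (h : i ≠ s) {X : DGMod Γ} {n : ℤ}
    (hs : (X.cpx s).Van (n + 1 + 1)) (hi : (X.cpx i).Van (n + 1 + 1)) :
    ((twist s X).cpx i).Van n := by
  intro v hv
  have hv₁ : (X.cpx i).d v.1 + X.x i s (ev v.2.2.1) = 0 :=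
    (congrArg ((X.cpx i).d v.1 + ·) (counit_of_ne h v.2).symm).trans (congrArg Prod.fst hv)
  have hv₂ : ∀ k, (X.cpx s).d (v.2.2.1 k) = 0 := fun k => congrArg (fun z => z.2.2.1 k) hv
  choose b hb using fun k => hs (v.2.2.1 k) (hv₂ k)
  have hb' : (X.cpx s).d (ev b) = ev v.2.2.1 := by
    rw [map_ev]
    exact congrArg ev (funext hb)
  obtain ⟨u, hu⟩ := hi (v.1 + X.x i s (ev b)) (by
    rw [map_add, ← X.x_d, hb', hv₁])
  refine ⟨(u, (0, b, 0)), ?_⟩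
  refine Prod.ext ?_ (Prod.ext ?_ (Prod.ext ?_ ?_))
  · refine (congrArg₂ (· + ·) hu (counit_of_ne h (0, b, 0))).trans ?_
    exact (add_assoc _ _ _).trans ((congrArg _ ((X.cpx i).add_self _)).trans (add_zero _))
  · exact funext fun k => absurd k.down h
  · exact funext fun k => hb k
  · exact funext fun k => absurd k.down h

/-- In lowest degree, the twist at `s` is injective on the cohomology at the other vertices. -/
theorem van_of_van_twist {i s : I} (h : i ≠ s) {X : DGMod Γ} {n : ℤ}
    (hs : (X.cpx s).Van (n + 1)) (hi : ((twist s X).cpx i).Van n) : (X.cpx i).Van (n + 1 + 1) := by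
  intro v hv
  obtain ⟨u, hu⟩ := hi (v, 0) (Prod.ext
    ((congrArg₂ (· + ·) hv (map_zero ((counit s X).hom i).f)).trans (add_zero _)) (map_zero _))
  have hu₁ : (X.cpx i).d u.1 + X.x i s (ev u.2.2.1) = v :=
    (congrArg ((X.cpx i).d u.1 + ·) (counit_of_ne h u.2).symm).trans (congrArg Prod.fst hu)
  have hu₂ : ∀ k, (X.cpx s).d (u.2.2.1 k) = 0 := fun k => congrArg (fun z => z.2.2.1 k) hu
  choose b hb using fun k => hs (u.2.2.1 k) (hu₂ k)
  refine ⟨u.1 + X.x i s (ev b), ?_⟩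
  rw [map_add, ← X.x_d, map_ev]
  exact (congrArg (fun z => (X.cpx i).d u.1 + X.x i s (ev z)) (funext hb)).trans hu₁

variable (Γ) in
/-- The module with the field of two elements in degree zero at every vertex, on which all edges and
loops act as zero. -/
abbrev base : DGMod Γ where
  cpx _ :=
    { C := fun n => On (n = 0) (ZMod 2)
      add_self := fun v => by ext k; exact CharTwo.add_self_eq_zero (v k)
      d := 0
      d_d := fun _ => rfl }
  x _ _ _ := 0
  l _ _ := 0
  x_d _ := rfl
  l_d _ := rfl
  x_not_adj _ _ := rfl
  x_x _ _ := rfl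
  x_x_ne _ _ := rfl
  x_l _ := rfl
  l_x _ := rfl
  l_l _ := rfl

theorem not_van_base (i : I) : ¬ ((base Γ).cpx i).Van (-1) := by
  intro h
  obtain ⟨u, hu⟩ := h (fun _ => (1 : ZMod 2)) rfl
  exact absurd (congrFun hu ⟨by norm_num⟩) (zero_ne_one (α := ZMod 2))

theorem van_base (i : I) {n : ℤ} (hn : n < -1) : ((base Γ).cpx i).Van n :=
  fun _ _ => ⟨0, funext fun k => absurd k.down (by omega)⟩

end DGMod

namespace DerivedClass

open DGMod

/-- `X.Van i n` says that the cohomology at the vertex `i` vanishes in degree `n + 1`. -/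
def Van (X : DerivedClass Γ) (i : I) (n : ℤ) : Prop :=
  Quot.lift (fun X => (X.cpx i).Van n) (fun _ _ ⟨_, hf⟩ => propext ((hf i).van_iff n)) X

/-- `X.Above n` says that the cohomology vanishes at all vertices in all degrees up to `n`. -/
def Above (X : DerivedClass Γ) (n : ℤ) : Prop := ∀ i m, m < n → X.Van i m

variable {X : DerivedClass Γ} {s t : I} {n : ℤ}

/-- After a twist at `s`, the cohomology at `s` in the lowest degree vanishes. -/
theorem van_twist_self (h : X.Above (n + 2)) : (X.twist s).Van s n := by
  have := h s (n + 1) (by omega)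
  obtain ⟨X⟩ := X
  exact (DGMod.van_twist_self s X n).2 this

theorem Above.twist (h : X.Above (n + 2)) : (X.twist s).Above n := by
  intro i m hm
  by_cases hi : i = s
  · subst hi
    exact van_twist_self fun j k hk => h j k (by omega)
  have h₁ := h s (m + 1 + 1) (by omega)
  have h₂ := h i (m + 1 + 1) (by omega)
  obtain ⟨X⟩ := X
  exact van_twist_of_ne hi h₁ h₂

theorem van_of_van_twist (h : X.Above (n + 2)) (hne : t ≠ s) (hv : (X.twist s).Van t n) :
    X.Van t (n + 2) := by
  have := h s (n + 1) (by omega)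
  obtain ⟨X⟩ := X
  have := DGMod.van_of_van_twist hne this hv
  rwa [add_assoc] at this

/-- For adjacent `s` and `t`, the cohomology of `X` at `t` is seen in the iterated twist of `X` at the
vertex `s`. -/
theorem van_of_van_twist_twist (h : Γ.Adj s t) (hv : ((X.twist s).twist t).Van s n) :
    X.Van t (n + 4) := by
  obtain ⟨X⟩ := X
  have : (X.cpx t).Van (n + 1 + 1 + 1 + 1) := ((braidGen_qis h X).van_iff n).2 hv
  rwa [show n + 1 + 1 + 1 + 1 = n + 4 by ring] at this

theorem twist_comm (hne : s ≠ t) (h : ¬ Γ.Adj s t) (X : DerivedClass Γ) :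
    (X.twist t).twist s = (X.twist s).twist t := by
  obtain ⟨X⟩ := X
  exact DGMod.twist_comm hne h X

theorem twist_braid (h : Γ.Adj s t) (X : DerivedClass Γ) :
    ((X.twist s).twist t).twist s = ((X.twist t).twist s).twist t := by
  obtain ⟨X⟩ := X
  exact DGMod.twist_braid h X

end DerivedClass

end Zigzag

/-! ### Alternating products and braid monoids -/

/-- The alternating product `a b a ⋯` with `k` factors. -/
def altProd {A : Type*} [Monoid A] (a b : A) : ℕ → A
  | 0 => 1
  | k + 1 => a * altProd b a k

theorem lift_alternatingWord {A B : Type*} [Monoid A] (f : B → A) (s t : B) (k : ℕ) :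
    FreeMonoid.lift f (FreeMonoid.ofList (CoxeterSystem.alternatingWord s t k)) =
      if Even k then altProd (f s) (f t) k else altProd (f t) (f s) k := by
  induction k with
  | zero => simp [CoxeterSystem.alternatingWord, altProd]
  | succ k ih =>
    rw [CoxeterSystem.alternatingWord_succ', FreeMonoid.ofList_cons, map_mul, ih]
    by_cases hk : Even k
    · simp [hk, Nat.even_add_one, altProd]
    · simp [hk, Nat.even_add_one, altProd]

namespace CoxeterMatrix

variable {B : Type u} (M : CoxeterMatrix B)

/-- The generators of the braid monoid. -/
abbrev gen (s : B) : M.BraidMonoid := PresentedMonoid.of _ s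

/-- The monoid homomorphism given by elements that satisfy the braid relations. -/
def braidLift {A : Type*} [Monoid A] (f : B → A)
    (hf : ∀ s t, s ≠ t → altProd (f s) (f t) (M s t) = altProd (f t) (f s) (M s t)) :
    M.BraidMonoid →* A :=
  PresentedMonoid.lift f (by
    rintro _ _ ⟨s, t, rfl, rfl⟩
    rw [CoxeterSystem.braidWord, CoxeterSystem.braidWord, lift_alternatingWord,
      lift_alternatingWord, M.symmetric t s]
    rcases eq_or_ne s t with rfl | h
    · rfl
    · rw [hf s t h])

@[simp] theorem braidLift_gen {A : Type*} [Monoid A] (f : B → A) (hf) (s : B) :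
    M.braidLift f hf (M.gen s) = f s := rfl

theorem altProd_gen (s t : B) :
    altProd (M.gen s) (M.gen t) (M s t) = altProd (M.gen t) (M.gen s) (M s t) := by
  have h := PresentedMonoid.mk_eq_mk_of_rel (rels := M.MonoidBraidRel) ⟨s, t, rfl, rfl⟩
  have e : PresentedMonoid.mk M.MonoidBraidRel = FreeMonoid.lift M.gen :=
    FreeMonoid.hom_eq fun s => rfl
  rw [e, CoxeterSystem.braidWord, CoxeterSystem.braidWord, lift_alternatingWord,
    lift_alternatingWord, M.symmetric t s] at h
  split_ifs at h with h'
  · exact h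
  · exact h.symm

/-- The length of an element of the braid monoid. -/
def len : M.BraidMonoid →* Multiplicative ℕ :=
  M.braidLift (fun _ => Multiplicative.ofAdd 1) fun _ _ _ => rfl

/-- The length of an element of the braid monoid, as a natural number. -/
def length (b : M.BraidMonoid) : ℕ := (M.len b).toAdd

@[simp] theorem length_one : M.length 1 = 0 := rfl

@[simp] theorem length_mul (a b : M.BraidMonoid) : M.length (a * b) = M.length a + M.length b := by
  simp [length]

@[simp] theorem length_gen (s : B) : M.length (M.gen s) = 1 := rfl

theorem eq_one_or_eq_gen_mul (b : M.BraidMonoid) : b = 1 ∨ ∃ s c, b = M.gen s * c := by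
  obtain ⟨w, rfl⟩ := PresentedMonoid.surjective_mk b
  induction w using FreeMonoid.casesOn with
  | one => exact .inl rfl
  | of_mul s w => exact .inr ⟨s, PresentedMonoid.mk _ w, map_mul _ _ _⟩

variable {M}

theorem eq_one_of_length_eq_zero {b : M.BraidMonoid} (h : M.length b = 0) : b = 1 := by
  rcases M.eq_one_or_eq_gen_mul b with rfl | ⟨s, c, rfl⟩
  · rfl
  · simp at h

end CoxeterMatrix

/-! ### Simply laced braid monoids -/

namespace CoxeterMatrix

variable {B : Type u} (M : CoxeterMatrix B)

/-- A Coxeter matrix is simply laced if its entries off the diagonal are two or three. -/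
def IsSimplyLaced : Prop := ∀ ⦃s t : B⦄, s ≠ t → M s t = 2 ∨ M s t = 3

/-- The graph of the pairs with `M s t = 3`. -/
def graph : SimpleGraph B where
  Adj s t := M s t = 3
  symm.symm s t h := (M.symmetric t s).trans h
  loopless.irrefl s h := by simp at h

theorem adj_graph {s t : B} : M.graph.Adj s t ↔ M s t = 3 := Iff.rfl

theorem gen_mul_gen_comm {s t : B} (h : M s t = 2) : M.gen s * M.gen t = M.gen t * M.gen s := by
  simpa [h, altProd] using M.altProd_gen s t

theorem gen_mul_gen_mul_gen {s t : B} (h : M s t = 3) :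
    M.gen s * (M.gen t * M.gen s) = M.gen t * (M.gen s * M.gen t) := by
  simpa [h, altProd] using M.altProd_gen s t

/-- The action of the braid monoid on classes of differential graded modules by spherical twists. -/
noncomputable def twistAction (hM : M.IsSimplyLaced) :
    M.BraidMonoid →* Equiv.Perm (Zigzag.DerivedClass M.graph) :=
  M.braidLift (fun s => Equiv.ofBijective _ (Zigzag.DerivedClass.twist_bijective s)) (by
    intro s t hst
    ext X
    rcases hM hst with h | h
    · simpa [h, altProd] using
        Zigzag.DerivedClass.twist_comm hst (by simp [adj_graph, h]) X
    · simpa [h, altProd] using Zigzag.DerivedClass.twist_braid (M.adj_graph.2 h) X)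

/-- The class of the base module under the action of an element of the braid monoid. -/
noncomputable def orbit (hM : M.IsSimplyLaced) (b : M.BraidMonoid) :
    Zigzag.DerivedClass M.graph :=
  M.twistAction hM b (Zigzag.DGMod.base M.graph).cls

variable {M} (hM : M.IsSimplyLaced)

theorem orbit_gen_mul (s : B) (b : M.BraidMonoid) :
    M.orbit hM (M.gen s * b) = (M.orbit hM b).twist s := by
  rw [orbit, map_mul]
  rfl

/-- The cohomology of the base module starts in degree zero, and every twist lowers this bound by
two. As `Van` counts degrees from `-1`, the bound is `-1 - 2 * length`. -/
theorem orbit_above (b : M.BraidMonoid) : (M.orbit hM b).Above (-1 - 2 * M.length b) := by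
  induction hn : M.length b generalizing b with
  | zero =>
    obtain rfl := eq_one_of_length_eq_zero hn
    exact fun i m hm => Zigzag.DGMod.van_base i (by simpa using hm)
  | succ n ih =>
    rcases M.eq_one_or_eq_gen_mul b with rfl | ⟨s, c, rfl⟩
    · simp at hn
    · rw [orbit_gen_mul]
      refine Zigzag.DerivedClass.Above.twist ?_
      have := ih c (by simp at hn; omega)
      convert this using 1
      push_cast
      ring

/-- Write `b = s c`. If the cohomology at `t ≠ s` vanishes in lowest degree, then it does so for `c`,
whence `t` divides `c`; if `s` and `t` are adjacent, the quotient is divisible by `s` as well, since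
its cohomology at `s` is seen at `t`. Then a braid relation brings `t` to the front. -/
theorem gen_dvd_of_van {t : B} (b : M.BraidMonoid)
    (h : (M.orbit hM b).Van t (-1 - 2 * M.length b)) : M.gen t ∣ b := by
  induction hn : M.length b using Nat.strong_induction_on generalizing b t with | _ n ih
  rcases M.eq_one_or_eq_gen_mul b with rfl | ⟨s, c, rfl⟩
  · have e : -1 - 2 * (M.length (1 : M.BraidMonoid) : ℤ) = -1 := by simp
    rw [e] at h
    exact absurd h (Zigzag.DGMod.not_van_base t)
  rcases eq_or_ne t s with rfl | hts
  · exact dvd_mul_right _ _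
  have hl : (-1 - 2 * (M.length (M.gen s * c) : ℤ)) + 2 = -1 - 2 * M.length c := by
    simp
    ring
  rw [orbit_gen_mul] at h
  have h' := Zigzag.DerivedClass.van_of_van_twist (by rw [hl]; exact orbit_above hM c) hts h
  rw [hl] at h'
  simp only [length_mul, length_gen] at hn
  obtain ⟨c, rfl⟩ := ih _ (by omega) _ h' rfl
  rcases hM hts with hm | hm
  · rw [← mul_assoc, ← gen_mul_gen_comm M hm, mul_assoc]
    exact dvd_mul_right _ _
  · rw [orbit_gen_mul] at h
    have h'' := Zigzag.DerivedClass.van_of_van_twist_twist (M.adj_graph.2 hm) h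
    have hl' : (-1 - 2 * (M.length (M.gen s * (M.gen t * c)) : ℤ)) + 4 = -1 - 2 * M.length c := by
      simp
      ring
    rw [hl'] at h''
    simp only [length_mul, length_gen] at hn
    obtain ⟨c, rfl⟩ := ih _ (by omega) _ h'' rfl
    refine ⟨M.gen s * (M.gen t * c), ?_⟩
    have := congrArg (· * c) (gen_mul_gen_mul_gen M hm)
    simpa [mul_assoc] using this.symm

/-- The vanishing of the cohomology in lowest degree detects left divisibility by a generator. -/
theorem gen_dvd_iff_van {t : B} {b : M.BraidMonoid} :
    M.gen t ∣ b ↔ (M.orbit hM b).Van t (-1 - 2 * M.length b) := by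
  refine ⟨?_, gen_dvd_of_van hM b⟩
  rintro ⟨c, rfl⟩
  rw [orbit_gen_mul]
  refine Zigzag.DerivedClass.van_twist_self ?_
  convert orbit_above hM c using 1
  simp
  ring

/-- An element is determined by its length and its effect on the base module. -/
theorem eq_of_orbit_eq {b c : M.BraidMonoid} (hl : M.length b = M.length c)
    (h : M.orbit hM b = M.orbit hM c) : b = c := by
  induction hn : M.length b generalizing b c with
  | zero => rw [eq_one_of_length_eq_zero hn, eq_one_of_length_eq_zero (hl.symm.trans hn)]
  | succ n ih =>
    rcases M.eq_one_or_eq_gen_mul b with rfl | ⟨s, b, rfl⟩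
    · simp at hn
    obtain ⟨c, rfl⟩ : M.gen s ∣ c :=
      (gen_dvd_iff_van hM).2 (h ▸ hl ▸ (gen_dvd_iff_van hM).1 (dvd_mul_right _ _))
    rw [orbit_gen_mul, orbit_gen_mul] at h
    simp only [length_mul, length_gen] at hn hl
    rw [ih (by omega) ((Zigzag.DerivedClass.twist_bijective s).1 h) (by omega)]

theorem mul_left_cancel_of_isSimplyLaced (hM : M.IsSimplyLaced) (a : M.BraidMonoid)
    {b c : M.BraidMonoid} (h : a * b = a * c) : b = c := by
  have hl := congrArg M.length h
  simp only [length_mul] at hl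
  refine eq_of_orbit_eq hM (by omega) ((M.twistAction hM a).injective ?_)
  simpa [orbit] using congrArg (M.orbit hM) h

theorem mul_dvd_mul_iff_left_of_isSimplyLaced (hM : M.IsSimplyLaced) (a : M.BraidMonoid)
    {b c : M.BraidMonoid} : a * b ∣ a * c ↔ b ∣ c := by
  refine ⟨?_, mul_dvd_mul_left a⟩
  rintro ⟨d, h⟩
  exact ⟨d, mul_left_cancel_of_isSimplyLaced hM a (h.trans (mul_assoc _ _ _))⟩

/-- The least common multiple of two commuting generators. -/
theorem gen_dvd_of_gen_dvd_gen_mul (hM : M.IsSimplyLaced) {s t : B} (hst : s ≠ t)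
    {c : M.BraidMonoid} (h : M.gen t ∣ M.gen s * c) : M.gen t ∣ c := by
  have h := (gen_dvd_iff_van hM).1 h
  have hl : (-1 - 2 * (M.length (M.gen s * c) : ℤ)) + 2 = -1 - 2 * M.length c := by
    simp
    ring
  rw [orbit_gen_mul] at h
  have h' := Zigzag.DerivedClass.van_of_van_twist (by rw [hl]; exact orbit_above hM c) hst.symm h
  rw [hl] at h'
  exact (gen_dvd_iff_van hM).2 h'

/-- The least common multiple of two generators that do not commute. -/
theorem gen_mul_gen_dvd_of_gen_dvd_gen_mul (hM : M.IsSimplyLaced) {s t : B} (hst : M s t = 3)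
    {c : M.BraidMonoid} (h : M.gen t ∣ M.gen s * c) : M.gen t * M.gen s ∣ c := by
  have hne : s ≠ t := by rintro rfl; simp at hst
  obtain ⟨c, rfl⟩ := gen_dvd_of_gen_dvd_gen_mul hM hne h
  rw [mul_dvd_mul_iff_left_of_isSimplyLaced hM]
  have h := (gen_dvd_iff_van hM).1 h
  rw [orbit_gen_mul, orbit_gen_mul] at h
  have h' := Zigzag.DerivedClass.van_of_van_twist_twist
    (M.adj_graph.2 ((M.symmetric t s).trans hst)) h
  refine (gen_dvd_iff_van hM).2 ?_
  convert h' using 1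
  simp
  ring

end CoxeterMatrix

/-! ### Alternating products in type A -/

section TypeA

variable {A : Type u} [Monoid A]

theorem altProd_succ_right (a b : A) (k : ℕ) :
    altProd a b (k + 1) = altProd a b k * if Even k then a else b := by
  induction k generalizing a b with
  | zero => simp [altProd]
  | succ k ih =>
    rw [altProd, ih b a, altProd, ← mul_assoc]
    simp only [Nat.even_add_one, ite_not]

/-- The product of the `g i` with `i < n` of the same parity as `c`, in increasing order. -/
def halfProd (g : ℕ → A) (c : ℕ) : ℕ → A
  | 0 => 1
  | n + 1 => halfProd g c n * if Even (n + c) then g n else 1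

theorem halfProd_congr (g : ℕ → A) {c c' : ℕ} (h : Even c ↔ Even c') (n : ℕ) :
    halfProd g c n = halfProd g c' n := by
  induction n with
  | zero => rfl
  | succ n ih => simp only [halfProd, ih, Nat.even_add, h]

theorem halfProd_add (g : ℕ → A) (c a r : ℕ) :
    halfProd g c (a + r) = halfProd g c a * halfProd (fun i => g (a + i)) (c + a) r := by
  induction r with
  | zero => simp [halfProd]
  | succ r ih => rw [← add_assoc, halfProd, ih, halfProd, mul_assoc, add_right_comm,
      add_comm a c, add_comm r]

theorem halfProd_one_succ (g : ℕ → A) (r : ℕ) :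
    halfProd g 1 (r + 1) = halfProd (fun i => g (1 + i)) 0 r := by
  rw [add_comm, halfProd_add, halfProd_congr _ (c := 1 + 1) (c' := 0) (by decide)]
  simp [halfProd]

theorem semiconjBy_halfProd {g g' : ℕ → A} {d : A} {r : ℕ}
    (h : ∀ i < r, SemiconjBy d (g i) (g' i)) (c : ℕ) :
    SemiconjBy d (halfProd g c r) (halfProd g' c r) := by
  induction r with
  | zero => exact SemiconjBy.one_right d
  | succ r ih =>
    refine (ih fun i hi => h i (by omega)).mul_right ?_
    split_ifs
    · exact h r (by omega)
    · exact SemiconjBy.one_right d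

theorem commute_halfProd {g : ℕ → A} {d : A} {r : ℕ} (h : ∀ i < r, Commute d (g i)) (c : ℕ) :
    Commute d (halfProd g c r) :=
  semiconjBy_halfProd h c

/-- The descending product `g (r + k - 1) ⋯ g (r + 1) * g r` with `k` factors. -/
def descProd (g : ℕ → A) (r : ℕ) : ℕ → A
  | 0 => 1
  | k + 1 => g (r + k) * descProd g r k

theorem descProd_succ' (g : ℕ → A) (r k : ℕ) :
    descProd g r (k + 1) = descProd g (r + 1) k * g r := by
  induction k with
  | zero => simp [descProd]
  | succ k ih => rw [descProd, ih, descProd, mul_assoc, add_right_comm r 1 k, add_assoc]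

theorem commute_descProd {g : ℕ → A} {d : A} {r k : ℕ}
    (h : ∀ i, r ≤ i → i < r + k → Commute d (g i)) : Commute d (descProd g r k) := by
  induction k with
  | zero => exact Commute.one_right d
  | succ k ih => exact (h _ (by omega) (by omega)).mul_right (ih fun i h₁ h₂ => h i h₁ (by omega))

/-- The product `g 0 * (g 1 * g 0) * (g 2 * g 1 * g 0) ⋯` of the descending products of the first
`n` elements; if the `g i` are the standard generators of a braid group, this is the half twist. -/
def halfTwist (g : ℕ → A) : ℕ → A
  | 0 => 1
  | n + 1 => halfTwist g n * descProd g 0 (n + 1)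

/-- The first `n` elements of the sequence `g` satisfy the braid relations of type `A`. -/
structure IsBraidSeq (g : ℕ → A) (n : ℕ) : Prop where
  braid : ∀ i, i + 1 < n → g i * (g (i + 1) * g i) = g (i + 1) * (g i * g (i + 1))
  comm : ∀ i j, i + 1 < j → j < n → Commute (g i) (g j)

theorem IsBraidSeq.mono {g : ℕ → A} {m n : ℕ} (h : IsBraidSeq g n) (hmn : m ≤ n) :
    IsBraidSeq g m :=
  ⟨fun i hi => h.braid i (by omega), fun i j hi hj => h.comm i j hi (by omega)⟩

/-- Moving a generator through a descending product lowers its index. -/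
theorem IsBraidSeq.semiconjBy_descProd {g : ℕ → A} {n : ℕ} (h : IsBraidSeq g n) {r k i : ℕ}
    (hn : r + k ≤ n) (hr : r ≤ i) (hi : i + 1 < r + k) :
    SemiconjBy (descProd g r k) (g (i + 1)) (g i) := by
  induction k with
  | zero => omega
  | succ k ih =>
    rcases Nat.lt_or_ge (i + 1) (r + k) with h' | h'
    · exact SemiconjBy.mul_left (h.comm i (r + k) h' (by omega)).symm (ih (by omega) h')
    · obtain ⟨k, rfl⟩ : ∃ k', k = k' + 1 := ⟨k - 1, by omega⟩
      obtain rfl : i = r + k := by omega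
      have hc : Commute (g (r + k + 1)) (descProd g r k) :=
        commute_descProd fun j h₁ h₂ => (h.comm j _ (by omega) (by omega)).symm
      rw [SemiconjBy, descProd, descProd, mul_assoc, mul_assoc, ← hc.eq, ← mul_assoc (g (r + k)),
        ← add_assoc, ← mul_assoc (g (r + k + 1)), ← h.braid (r + k) (by omega)]
      simp only [mul_assoc]

/-- The alternating product of the two halves of the sequence `g`. -/
def altHalf (g : ℕ → A) (n c k : ℕ) : A := altProd (halfProd g c n) (halfProd g (c + 1) n) k

theorem altHalf_congr (g : ℕ → A) {c c' : ℕ} (h : Even c ↔ Even c') (n k : ℕ) :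
    altHalf g n c k = altHalf g n c' k := by
  rw [altHalf, altHalf, halfProd_congr g h, halfProd_congr g (c := c + 1) (c' := c' + 1)]
  simp only [Nat.even_add_one, h]

theorem altHalf_succ (g : ℕ → A) (n c k : ℕ) :
    altHalf g n c (k + 1) = halfProd g c n * altHalf g n (c + 1) k := by
  rw [altHalf, altProd, altHalf, halfProd_congr g (c := c + 1 + 1) (c' := c)]
  simp [Nat.even_add_one]

theorem altHalf_succ_right (g : ℕ → A) (n c k : ℕ) :
    altHalf g n c (k + 1) = altHalf g n c k * halfProd g (c + k) n := by
  rw [altHalf, altProd_succ_right, altHalf]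
  congr 1
  split_ifs with h
  · exact halfProd_congr g (by simp [Nat.even_add, h]) n
  · exact halfProd_congr g (by simp [Nat.even_add, h]) n

/-- In the alternating product for `n + 1` elements, the occurrences of the last element and of the
elements that it meets can be collected into a descending product. -/
theorem IsBraidSeq.altHalf_eq {g : ℕ → A} (j r : ℕ) (h : IsBraidSeq g (j + r + 1)) :
    altHalf g (j + r + 1) (j + r) (j + 1) =
      altHalf g (j + r) (j + r) j * (halfProd g r r * descProd g r (j + 1)) := by
  induction j generalizing r with
  | zero => simp [altHalf, altProd, halfProd, descProd]
  | succ j ih =>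
    have ih := ih (r + 1) (by convert h using 1; ring)
    rw [show j + (r + 1) = j + 1 + r by ring] at ih
    rw [altHalf_succ_right, ih,
      halfProd_congr g (c := j + 1 + r + (j + 1)) (c' := r) (by rw [Nat.even_iff, Nat.even_iff]; omega),
      show j + 1 + r + 1 = (r + 1) + (j + 1) by ring, halfProd_add g r (r + 1) (j + 1),
      halfProd_congr _ (c := r + (r + 1)) (c' := 1) (by rw [Nat.even_iff, Nat.even_iff]; omega),
        halfProd_one_succ,
      altHalf_succ_right,
      halfProd_congr g (c := j + 1 + r + j) (c' := r + 1) (by rw [Nat.even_iff, Nat.even_iff]; omega),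
      show j + 1 + r = (r + 1) + j by ring, halfProd_add g (r + 1) (r + 1) j,
      halfProd_congr _ (c := r + 1 + (r + 1)) (c' := 0) (by rw [Nat.even_iff, Nat.even_iff]; omega),
      show halfProd g r (r + 1) = halfProd g r r * g r by simp [halfProd], descProd_succ' g r]
    set T := halfProd (fun i => g (r + 1 + i)) 0 j
    set T' := halfProd (fun i => g (r + 1 + (1 + i))) 0 j
    set D := descProd g (r + 1) (j + 1)
    set H := halfProd g r r
    have h₁ : Commute H D := commute_descProd fun i hi hi' =>
      (commute_halfProd (fun k hk => (h.comm k i (by omega) (by omega)).symm) _).symm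
    have h₂ : Commute (g r) T' := commute_halfProd (fun i hi => h.comm r _ (by omega) (by omega)) _
    have h₃ : D * T' = T * D := semiconjBy_halfProd (fun i hi => by
      rw [show r + 1 + (1 + i) = r + 1 + i + 1 by ring]
      exact h.semiconjBy_descProd (by omega) (by omega) (by omega)) _
    have h₄ : Commute H T := commute_halfProd (fun i hi =>
      (commute_halfProd (fun k hk => (h.comm k _ (by omega) (by omega)).symm) _).symm) _
    simp only [mul_assoc]
    rw [h₂.eq, ← mul_assoc D H, ← h₁.eq, mul_assoc H D, ← mul_assoc D T', h₃, mul_assoc T D,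
      ← mul_assoc H T, h₄.eq, mul_assoc T H]

/-- In type `A`, both alternating products of the two halves are equal to the half twist. The last
element is collected into a descending product by `IsBraidSeq.altHalf_eq`, and the rest is an
alternating product for the remaining elements. -/
theorem IsBraidSeq.altHalf_eq_halfTwist {g : ℕ → A} {n : ℕ} (h : IsBraidSeq g n) (c : ℕ) :
    altHalf g n c (n + 1) = halfTwist g n := by
  induction n generalizing c with
  | zero => simp [altHalf, altProd, halfProd, halfTwist]
  | succ n ih =>
    have ih := ih (h.mono n.le_succ)
    have e : altHalf g (n + 1) n (n + 1) = altHalf g n n n * descProd g 0 (n + 1) := by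
      simpa [halfProd] using IsBraidSeq.altHalf_eq n 0 h
    by_cases hc : Even c ↔ Even n
    · rw [altHalf_congr g hc, altHalf_succ_right, e,
        halfProd_congr g (c := n + (n + 1)) (c' := 1) (by rw [Nat.even_iff, Nat.even_iff]; omega),
        halfProd_one_succ,
        mul_assoc, (semiconjBy_halfProd (g' := g) (r := n) (d := descProd g 0 (n + 1)) (fun i hi => by
          rw [add_comm 1 i]
          exact h.semiconjBy_descProd (by omega) (by omega) (by omega)) 0).eq, ← mul_assoc,
        halfTwist, ← ih n, altHalf_succ_right,
        halfProd_congr g (c := n + n) (c' := 0) (by rw [Nat.even_iff, Nat.even_iff]; omega)]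
    · rw [altHalf_congr g (c' := n + 1) (by rw [Nat.even_iff, Nat.even_iff] at *; omega), altHalf_succ,
        altHalf_congr g (c := n + 1 + 1) (c' := n) (by rw [Nat.even_iff, Nat.even_iff]; omega), e,
        halfTwist,
        ← ih (n + 1), altHalf_succ,
        altHalf_congr g (c := n + 1 + 1) (c' := n) (by rw [Nat.even_iff, Nat.even_iff]; omega), mul_assoc]
      congr 1
      simp [halfProd]

end TypeA

/-! ### Least common multiples in simply laced braid monoids -/

namespace CoxeterMatrix

variable {B : Type u} {M : CoxeterMatrix B}

variable (M) in
/-- The submonoid of the braid monoid generated by a set of generators. -/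
def parabolic (J : Set B) : Submonoid M.BraidMonoid := Submonoid.closure (M.gen '' J)

theorem gen_mem_parabolic {J : Set B} {s : B} (h : s ∈ J) : M.gen s ∈ M.parabolic J :=
  Submonoid.subset_closure ⟨s, h, rfl⟩

theorem parabolic_mono {J K : Set B} (h : J ⊆ K) : M.parabolic J ≤ M.parabolic K :=
  Submonoid.closure_mono (Set.image_mono h)

theorem commute_of_mem_parabolic {J K : Set B} (h : ∀ s ∈ J, ∀ t ∈ K, M s t = 2)
    {u v : M.BraidMonoid} (hu : u ∈ M.parabolic J) (hv : v ∈ M.parabolic K) : Commute u v := by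
  induction hu using Submonoid.closure_induction with
  | one => exact Commute.one_left v
  | mul a b _ _ ha hb => exact ha.mul_left hb
  | mem u hu =>
    obtain ⟨s, hs, rfl⟩ := hu
    induction hv using Submonoid.closure_induction with
    | one => exact Commute.one_right _
    | mul a b _ _ ha hb => exact ha.mul_right hb
    | mem v hv =>
      obtain ⟨t, ht, rfl⟩ := hv
      exact gen_mul_gen_comm M (h s hs t ht)

theorem ne_of_eq_two {s t : B} (h : M s t = 2) : s ≠ t := by
  rintro rfl
  simp at h

theorem gen_dvd_of_gen_dvd_mul (hM : M.IsSimplyLaced) {J : Set B} {t : B}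
    (h : ∀ s ∈ J, M s t = 2) {u c : M.BraidMonoid} (hu : u ∈ M.parabolic J)
    (hc : M.gen t ∣ u * c) : M.gen t ∣ c := by
  induction hu using Submonoid.closure_induction generalizing c with
  | one => rwa [one_mul] at hc
  | mul a b _ _ ha hb => exact hb (ha (by rwa [mul_assoc] at hc))
  | mem u hu =>
    obtain ⟨s, hs, rfl⟩ := hu
    exact gen_dvd_of_gen_dvd_gen_mul hM (ne_of_eq_two (h s hs)) hc

/-- The product of elements of two commuting parabolic submonoids without common generators is a
least common multiple of them. An entry two forces the generators to be different. -/
theorem dvd_of_dvd_mul (hM : M.IsSimplyLaced) {J K : Set B} (h : ∀ s ∈ J, ∀ t ∈ K, M s t = 2)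
    {u v c : M.BraidMonoid} (hu : u ∈ M.parabolic J) (hv : v ∈ M.parabolic K)
    (hc : v ∣ u * c) : v ∣ c := by
  induction hv using Submonoid.closure_induction generalizing c with
  | one => exact one_dvd c
  | mul a b ha hb iha ihb =>
    obtain ⟨c, rfl⟩ := iha ((dvd_mul_right a b).trans hc)
    rw [← mul_assoc, (commute_of_mem_parabolic h hu ha).eq, mul_assoc,
      mul_dvd_mul_iff_left_of_isSimplyLaced hM] at hc
    rw [mul_dvd_mul_iff_left_of_isSimplyLaced hM]
    exact ihb hc
  | mem v hv =>
    obtain ⟨t, ht, rfl⟩ := hv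
    exact gen_dvd_of_gen_dvd_mul hM (fun s hs => h s hs t ht) hu hc

/-- A sequence of generators that forms a Coxeter graph of type `A`. -/
structure IsChain (M : CoxeterMatrix B) (v : ℕ → B) (n : ℕ) : Prop where
  three : ∀ i, i + 1 < n → M (v i) (v (i + 1)) = 3
  two : ∀ i j, i + 1 < j → j < n → M (v i) (v j) = 2

variable {v : ℕ → B} {n : ℕ}

theorem IsChain.mono {m : ℕ} (h : M.IsChain v n) (hmn : m ≤ n) : M.IsChain v m :=
  ⟨fun i hi => h.three i (by omega), fun i j hi hj => h.two i j hi (by omega)⟩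

theorem IsChain.isBraidSeq (h : M.IsChain v n) : IsBraidSeq (fun i => M.gen (v i)) n :=
  ⟨fun i hi => gen_mul_gen_mul_gen M (h.three i hi),
    fun i j hi hj => gen_mul_gen_comm M (h.two i j hi hj)⟩

theorem descProd_mem_parabolic (v : ℕ → B) (k : ℕ) :
    descProd (fun i => M.gen (v i)) 0 k ∈ M.parabolic (v '' Set.Iio k) := by
  induction k with
  | zero => exact one_mem _
  | succ k ih =>
    refine mul_mem (gen_mem_parabolic ⟨0 + k, by simp, rfl⟩) (parabolic_mono ?_ ih)
    exact Set.image_mono fun i hi => Nat.lt_succ_of_lt hi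

theorem halfTwist_mem_parabolic (v : ℕ → B) (k : ℕ) :
    halfTwist (fun i => M.gen (v i)) k ∈ M.parabolic (v '' Set.Iio k) := by
  induction k with
  | zero => exact one_mem _
  | succ k ih =>
    refine mul_mem (parabolic_mono ?_ ih) (descProd_mem_parabolic v (k + 1))
    exact Set.image_mono fun i hi => Nat.lt_succ_of_lt hi

/-- If `v k` divides `v (k - 1) ⋯ v 0 * c`, then it can be moved through, and picks up one factor at
each step. -/
theorem IsChain.descProd_dvd (hM : M.IsSimplyLaced) {k : ℕ} (h : M.IsChain v (k + 1))
    {c : M.BraidMonoid} (hc : M.gen (v k) ∣ descProd (fun i => M.gen (v i)) 0 k * c) :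
    descProd (fun i => M.gen (v i)) 0 (k + 1) ∣ c := by
  induction k generalizing c with
  | zero => simpa [descProd] using hc
  | succ k ih =>
    have hfar : ∀ s ∈ v '' Set.Iio k, ∀ t ∈ ({v (k + 1)} : Set B), M s t = 2 := by
      rintro _ ⟨i, hi, rfl⟩ _ rfl
      have hi : i < k := hi
      exact h.two i (k + 1) (by omega) (by omega)
    have hD := descProd_mem_parabolic (M := M) v k
    simp only [descProd, zero_add, mul_assoc] at hc ⊢
    have hc := gen_mul_gen_dvd_of_gen_dvd_gen_mul hM (h.three k (by omega)) hc
    obtain ⟨c, rfl⟩ := dvd_of_dvd_mul hM hfar hD (gen_mem_parabolic rfl)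
      ((dvd_mul_right _ _).trans hc)
    rw [← mul_assoc, (commute_of_mem_parabolic hfar hD (gen_mem_parabolic rfl)).eq, mul_assoc,
      mul_dvd_mul_iff_left_of_isSimplyLaced hM] at hc
    rw [mul_dvd_mul_iff_left_of_isSimplyLaced hM]
    simpa [descProd] using ih (h.mono (by omega)) hc

/-- The half twist of a chain of generators is a least common multiple of these generators. -/
theorem IsChain.halfTwist_dvd (hM : M.IsSimplyLaced) (h : M.IsChain v n) {c : M.BraidMonoid}
    (hc : ∀ i < n, M.gen (v i) ∣ c) : halfTwist (fun i => M.gen (v i)) n ∣ c := by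
  induction n with
  | zero => exact one_dvd c
  | succ n ih =>
    obtain ⟨d, rfl⟩ := ih (h.mono (by omega)) fun i hi => hc i (by omega)
    rw [halfTwist, mul_dvd_mul_iff_left_of_isSimplyLaced hM]
    refine h.descProd_dvd hM ?_
    have hn := hc n (by omega)
    cases n with
    | zero => simpa [halfTwist, descProd] using hn
    | succ n =>
      rw [halfTwist, mul_assoc] at hn
      refine gen_dvd_of_gen_dvd_mul hM (J := v '' Set.Iio n) ?_ (halfTwist_mem_parabolic v n) hn
      rintro _ ⟨i, hi, rfl⟩
      have hi : i < n := hi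
      exact h.two i (n + 1) (by omega) (by omega)

end CoxeterMatrix

/-! ### Products of commuting sequences -/

section SeqProd

variable {A : Type u} [Monoid A]

/-- The product `g 0 * g 1 * ⋯ * g (n - 1)`. -/
def seqProd (g : ℕ → A) : ℕ → A
  | 0 => 1
  | n + 1 => seqProd g n * g n

theorem commute_seqProd {g : ℕ → A} {a : A} {n : ℕ} (h : ∀ i < n, Commute a (g i)) :
    Commute a (seqProd g n) := by
  induction n with
  | zero => exact Commute.one_right a
  | succ n ih => exact (ih fun i hi => h i (by omega)).mul_right (h n (by omega))

theorem seqProd_congr {g g' : ℕ → A} {n : ℕ} (h : ∀ i < n, g i = g' i) :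
    seqProd g n = seqProd g' n := by
  induction n with
  | zero => rfl
  | succ n ih => rw [seqProd, seqProd, ih fun i hi => h i (by omega), h n (by omega)]

theorem seqProd_add (g : ℕ → A) (a r : ℕ) :
    seqProd g (a + r) = seqProd g a * seqProd (fun i => g (a + i)) r := by
  induction r with
  | zero => simp [seqProd]
  | succ r ih => rw [← add_assoc, seqProd, ih, seqProd, mul_assoc]

theorem dvd_seqProd {g : ℕ → A} {n : ℕ} (h : ∀ i < n, ∀ j < n, Commute (g i) (g j)) {i : ℕ}
    (hi : i < n) : g i ∣ seqProd g n := by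
  induction n with
  | zero => omega
  | succ n ih =>
    rcases Nat.lt_succ_iff_lt_or_eq.1 hi with h' | rfl
    · exact (ih (fun i hi j hj => h i (by omega) j (by omega)) h').mul_right _
    · rw [seqProd, ← (commute_seqProd fun j hj => h i hi j (by omega)).eq]
      exact dvd_mul_right _ _

theorem halfProd_congr_fun {g g' : ℕ → A} {c n : ℕ} (h : ∀ i, i < n → Even (i + c) → g i = g' i) :
    halfProd g c n = halfProd g' c n := by
  induction n with
  | zero => rfl
  | succ n ih =>
    rw [halfProd, halfProd, ih fun i hi => h i (by omega)]
    split_ifs with h'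
    · rw [h n (by omega) h']
    · rfl

/-- A product of commuting elements is the product of its two halves. -/
theorem seqProd_eq_halfProd_mul_halfProd {g : ℕ → A} {n : ℕ}
    (h : ∀ i < n, ∀ j < n, Commute (g i) (g j)) (c : ℕ) :
    seqProd g n = halfProd g c n * halfProd g (c + 1) n := by
  induction n with
  | zero => simp [seqProd, halfProd]
  | succ n ih =>
    rw [seqProd, ih fun i hi j hj => h i (by omega) j (by omega), halfProd, halfProd]
    have hc : Commute (g n) (halfProd g (c + 1) n) :=
      commute_halfProd (fun i hi => h n (by omega) i (by omega)) _
    by_cases h' : Even (n + c)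
    · rw [if_pos h', if_neg (by rw [← add_assoc, Nat.even_add_one]; simpa using h'), mul_one,
        mul_assoc, mul_assoc, hc.eq]
    · rw [if_neg h', if_pos (by rw [← add_assoc, Nat.even_add_one]; simpa using h'), mul_one,
        mul_assoc]

theorem commute_altProd {a b c : A} (ha : Commute c a) (hb : Commute c b) (k : ℕ) :
    Commute c (altProd a b k) := by
  induction k generalizing a b with
  | zero => exact Commute.one_right c
  | succ k ih => exact ha.mul_right (ih hb ha)

theorem altProd_mul_mul {a b a' b' : A} (h₁ : Commute a a') (h₂ : Commute a b') (h₃ : Commute b a')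
    (h₄ : Commute b b') (k : ℕ) :
    altProd (a * a') (b * b') k = altProd a b k * altProd a' b' k := by
  induction k generalizing a b a' b' with
  | zero => simp [altProd]
  | succ k ih =>
    rw [altProd, ih h₄ h₃ h₂ h₁, altProd, altProd, mul_assoc, ← mul_assoc a',
      (commute_altProd h₃.symm h₁.symm k).eq]
    simp only [mul_assoc]

theorem altProd_seqProd {a b : ℕ → A} {n : ℕ} (haa : ∀ i j, i < j → j < n → Commute (a i) (a j))
    (hab : ∀ i j, i < j → j < n → Commute (a i) (b j))
    (hba : ∀ i j, i < j → j < n → Commute (b i) (a j))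
    (hbb : ∀ i j, i < j → j < n → Commute (b i) (b j)) (k : ℕ) :
    altProd (seqProd a n) (seqProd b n) k = seqProd (fun i => altProd (a i) (b i) k) n := by
  induction n with
  | zero =>
    induction k with
    | zero => rfl
    | succ k ih => simpa [altProd, seqProd] using ih
  | succ n ih =>
    have h : ∀ {f g : ℕ → A}, (∀ i j, i < j → j < n + 1 → Commute (f i) (g j)) →
        Commute (seqProd f n) (g n) := fun h =>
      (commute_seqProd fun i hi => (h i n hi (by omega)).symm).symm
    rw [seqProd, seqProd, altProd_mul_mul (h haa) (h hab) (h hba) (h hbb),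
      ih (fun i j hi hj => haa i j hi (by omega)) (fun i j hi hj => hab i j hi (by omega))
        (fun i j hi hj => hba i j hi (by omega)) (fun i j hi hj => hbb i j hi (by omega)), seqProd]

end SeqProd

/-! ### The simply laced unfolding -/

namespace CoxeterMatrix

variable {B : Type u} (M : CoxeterMatrix B)

open Classical in
/-- The simply laced unfolding of a Coxeter matrix. Every generator has a copy for every natural
number. For generators `s ≠ t`, the copies of `s` and `t` with consecutive indices are joined, unless
the larger index is a multiple of `M s t - 1`; thus the copies form chains of `M s t - 1`
elements each, in which copies of `s` and `t` alternate. -/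
noncomputable def unfolding : CoxeterMatrix (B × ℕ) where
  M := Matrix.of fun p q => if p = q then 1 else
    if p.1 ≠ q.1 ∧ (p.2 + 1 = q.2 ∨ q.2 + 1 = p.2) ∧ ¬ M p.1 q.1 - 1 ∣ max p.2 q.2 then 3 else 2
  isSymm := by
    ext p q
    simp only [Matrix.transpose_apply, Matrix.of_apply, eq_comm (a := p), ne_comm (a := p.1),
      M.symmetric p.1, max_comm p.2, or_comm (a := p.2 + 1 = q.2)]
  diagonal p := by simp
  off_diagonal p q h := by
    simp only [Matrix.of_apply, h, if_false]
    split_ifs <;> simp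

theorem unfolding_apply {p q : B × ℕ} (h : p ≠ q) [Decidable (p.1 ≠ q.1 ∧
    (p.2 + 1 = q.2 ∨ q.2 + 1 = p.2) ∧ ¬ M p.1 q.1 - 1 ∣ max p.2 q.2)] : M.unfolding p q =
    if p.1 ≠ q.1 ∧ (p.2 + 1 = q.2 ∨ q.2 + 1 = p.2) ∧ ¬ M p.1 q.1 - 1 ∣ max p.2 q.2 then 3 else 2 := by
  refine (if_neg h).trans ?_
  congr

theorem unfolding_isSimplyLaced : M.unfolding.IsSimplyLaced := by
  classical
  intro p q h
  rw [unfolding_apply M h]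
  split_ifs
  · exact .inr rfl
  · exact .inl rfl

variable {M}

theorem unfolding_eq_two {p q : B × ℕ} (h : p ≠ q) (h' : ¬ (p.1 ≠ q.1 ∧
    (p.2 + 1 = q.2 ∨ q.2 + 1 = p.2) ∧ ¬ M p.1 q.1 - 1 ∣ max p.2 q.2)) : M.unfolding p q = 2 := by
  classical
  rw [unfolding_apply M h, if_neg h']

theorem unfolding_eq_three {p q : B × ℕ} (h₁ : p.1 ≠ q.1) (h₂ : p.2 + 1 = q.2 ∨ q.2 + 1 = p.2)
    (h₃ : ¬ M p.1 q.1 - 1 ∣ max p.2 q.2) : M.unfolding p q = 3 := by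
  classical
  rw [unfolding_apply M (fun e => h₁ (congrArg Prod.fst e)), if_pos ⟨h₁, h₂, h₃⟩]

variable {s t : B} {n : ℕ}

open Classical in
/-- The chains in the unfolding formed by the copies of `s` and `t`. The chains `2 * k` and
`2 * k + 1` involve the indices from `k * n` to `k * n + n - 1`. -/
noncomputable def chain (s t : B) (n j i : ℕ) : B × ℕ :=
  (if Even (i + j) then s else t, j / 2 * n + i)

theorem chain_isChain (hst : s ≠ t) (hn : M s t = n + 1) (j : ℕ) :
    M.unfolding.IsChain (chain s t n j) n := by
  have hn' : M t s = n + 1 := (M.symmetric s t).symm.trans hn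
  constructor
  · intro i hi
    have hd : ¬ n ∣ j / 2 * n + (i + 1) := by
      rw [Nat.dvd_add_right (Dvd.intro_left _ rfl)]
      exact Nat.not_dvd_of_pos_of_lt i.succ_pos hi
    by_cases h : Even (i + j)
    · have h' : ¬ Even (i + 1 + j) := by rwa [add_right_comm, Nat.even_add_one, not_not]
      refine unfolding_eq_three ?_ ?_ ?_
      · simpa [chain, h, h'] using hst
      · simp [chain, add_assoc]
      · simpa [chain, h, h', hn] using hd
    · have h' : Even (i + 1 + j) := by rwa [add_right_comm, Nat.even_add_one]
      refine unfolding_eq_three ?_ ?_ ?_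
      · simpa [chain, h, h'] using hst.symm
      · simp [chain, add_assoc]
      · simpa [chain, h, h', hn'] using hd
  · intro i k hik hk
    refine unfolding_eq_two ?_ ?_
    · simp only [chain, ne_eq, Prod.mk.injEq, not_and]
      omega
    · simp only [chain]
      omega

/-- Different chains of copies of `s` and `t` commute. -/
theorem unfolding_chain_eq_two (hn : M s t = n + 1) {j j' i i' : ℕ}
    (hj : j ≠ j') (hi : i < n) (hi' : i' < n) :
    M.unfolding (chain s t n j i) (chain s t n j' i') = 2 := by
  have hn' : M t s = n + 1 := (M.symmetric s t).symm.trans hn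
  have key : ∀ {a b i i' : ℕ}, i < n → i' < n → a * n + i = b * n + i' → a = b ∧ i = i' := by
    intro a b i i' hi hi' e
    have h₁ := congrArg (· / n) e
    have h₂ := congrArg (· % n) e
    simp only [mul_comm _ n] at h₁ h₂
    rw [Nat.mul_add_div (by omega), Nat.mul_add_div (by omega), Nat.div_eq_of_lt hi,
      Nat.div_eq_of_lt hi'] at h₁
    rw [Nat.mul_add_mod, Nat.mul_add_mod, Nat.mod_eq_of_lt hi, Nat.mod_eq_of_lt hi'] at h₂
    exact ⟨h₁, h₂⟩
  -- Consecutive indices in two different chains: either the copies belong to the same generator, or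
  -- the larger index starts a new block.
  have step : ∀ {j j' i i' : ℕ}, j ≠ j' → i < n → i' < n →
      ((if Even (i + j) then s else t) ≠ if Even (i' + j') then s else t) →
      j / 2 * n + i + 1 = j' / 2 * n + i' → n ∣ j' / 2 * n + i' := by
    intro j j' i i' hj hi hi' h e
    rcases Nat.lt_or_ge (i + 1) n with h' | h'
    · obtain ⟨h₁, rfl⟩ := key h' hi' e
      exfalso
      have : Even (i + j) ↔ ¬ Even (i + 1 + j') := by
        by_contra hc
        have : Even (i + j) ↔ Even (i + 1 + j') := by tauto
        simp [this] at h
      rw [Nat.even_iff, Nat.even_iff] at this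
      omega
    · rw [← e, show j / 2 * n + i + 1 = (j / 2 + 1) * n by rw [add_one_mul]; omega]
      exact Dvd.intro_left _ rfl
  refine unfolding_eq_two ?_ ?_
  · intro e
    simp only [chain, Prod.mk.injEq] at e
    obtain ⟨h₁, rfl⟩ := key hi hi' e.2
    by_cases h : Even (i + j) ↔ Even (i + j')
    · rw [Nat.even_iff, Nat.even_iff] at h
      omega
    · have hst : s = t := by
        by_cases h' : Even (i + j)
        · have h'' : ¬ Even (i + j') := by tauto
          simpa [h', h''] using e.1
        · have h'' : Even (i + j') := by tauto
          simpa [h', h''] using e.1.symm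
      subst hst
      simp at hn
      omega
  · rintro ⟨h₁, h₂, h₃⟩
    simp only [chain] at h₁ h₂ h₃
    have hm : M (if Even (i + j) then s else t) (if Even (i' + j') then s else t) - 1 = n := by
      by_cases h : Even (i + j) <;> by_cases h' : Even (i' + j') <;> simp [h, h', hn, hn'] at h₁ ⊢
    rw [hm] at h₃
    rcases h₂ with h₂ | h₂
    · rw [max_eq_right (by omega)] at h₃
      exact h₃ (step hj hi hi' h₁ h₂)
    · rw [max_eq_left (by omega)] at h₃
      exact h₃ (step hj.symm hi' hi h₁.symm h₂)

variable (M) in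
/-- The product of the first `N` copies of a generator in the unfolding. -/
noncomputable def layer (N : ℕ) (s : B) : M.unfolding.BraidMonoid :=
  seqProd (fun x => M.unfolding.gen (s, x)) N

theorem commute_layer (s : B) (x y : ℕ) :
    Commute (M.unfolding.gen (s, x)) (M.unfolding.gen (s, y)) := by
  rcases eq_or_ne x y with rfl | h
  · exact Commute.refl _
  · exact gen_mul_gen_comm _ (unfolding_eq_two (by simpa using h) (by simp))

theorem gen_dvd_layer {N x : ℕ} (s : B) (h : x < N) : M.unfolding.gen (s, x) ∣ M.layer N s :=
  dvd_seqProd (g := fun x => M.unfolding.gen (s, x)) (fun _ _ _ _ => commute_layer s _ _) h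

theorem length_layer (N : ℕ) (s : B) : M.unfolding.length (M.layer N s) = N := by
  induction N with
  | zero => rfl
  | succ N ih => rw [layer, seqProd, length_mul, ← layer, ih, length_gen]

/-- The layer of a generator is distributed over the halves of the chains. -/
theorem layer_eq {r : B} (e : ℕ)
    (h : ∀ i j, Even (i + (j + e)) → chain s t n j i = (r, j / 2 * n + i)) (K : ℕ) :
    M.layer (K * n) r =
      seqProd (fun j => halfProd (fun i => M.unfolding.gen (chain s t n j i)) (j + e) n) (2 * K) := by
  induction K with
  | zero => simp [layer, seqProd]
  | succ K ih =>
    rw [layer, add_one_mul, seqProd_add, ← layer, ih, mul_add_one, seqProd, seqProd, mul_assoc,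
      seqProd_eq_halfProd_mul_halfProd (fun i _ j _ => commute_layer r _ _) (2 * K + e)]
    congr 2
    · refine halfProd_congr_fun fun i _ hi => ?_
      rw [h _ _ hi, show 2 * K / 2 = K by omega]
    · rw [add_right_comm]
      refine halfProd_congr_fun fun i _ hi => ?_
      rw [h _ _ hi, show (2 * K + 1) / 2 = K by omega]

/-- The alternating product of two layers is the product of the half twists of the chains. The parity
`e` selects the order of the two layers. -/
theorem altProd_layer_eq (hst : s ≠ t) (hn : M s t = n + 1) (K : ℕ) {r r' : B} (e : ℕ)
    (h : ∀ i j, Even (i + (j + e)) → chain s t n j i = (r, j / 2 * n + i))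
    (h' : ∀ i j, Even (i + (j + (e + 1))) → chain s t n j i = (r', j / 2 * n + i)) :
    altProd (M.layer (K * n) r) (M.layer (K * n) r') (M s t) = seqProd (fun j =>
      halfTwist (fun i => M.unfolding.gen (chain s t n j i)) n) (2 * K) := by
  rw [layer_eq e h K, layer_eq (e + 1) h' K, altProd_seqProd, hn]
  · exact seqProd_congr fun j _ => (chain_isChain hst hn j).isBraidSeq.altHalf_eq_halfTwist (j + e)
  all_goals
    intro j j' hj hj'
    refine commute_halfProd (fun i' hi' => (commute_halfProd (fun i hi => ?_) _).symm) _
    exact (gen_mul_gen_comm _ (unfolding_chain_eq_two hn hj.ne hi hi')).symm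

theorem altProd_layer (hst : s ≠ t) (hn : M s t = n + 1) (K : ℕ) :
    altProd (M.layer (K * n) s) (M.layer (K * n) t) (M s t) = seqProd (fun j =>
      halfTwist (fun i => M.unfolding.gen (chain s t n j i)) n) (2 * K) := by
  refine altProd_layer_eq hst hn K 0 (fun i j h => by simp_all [chain]) fun i j h => ?_
  rw [← add_assoc, ← add_assoc, Nat.even_add_one] at h
  simp_all [chain]

theorem altProd_layer_swap (hst : s ≠ t) (hn : M s t = n + 1) (K : ℕ) :
    altProd (M.layer (K * n) t) (M.layer (K * n) s) (M s t) = seqProd (fun j =>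
      halfTwist (fun i => M.unfolding.gen (chain s t n j i)) n) (2 * K) := by
  refine altProd_layer_eq hst hn K 1 (fun i j h => ?_) fun i j h => ?_
  · rw [← add_assoc, Nat.even_add_one] at h
    simp [chain, h]
  · rw [← add_assoc, ← add_assoc, Nat.even_add_one, Nat.even_add_one, not_not] at h
    simp_all [chain]

theorem seqProd_dvd (hM : M.IsSimplyLaced) {J : ℕ → Set B} {u : ℕ → M.BraidMonoid} {K : ℕ}
    (hJ : ∀ i j, i < j → j < K → ∀ s ∈ J i, ∀ t ∈ J j, M s t = 2)
    (hu : ∀ i, u i ∈ M.parabolic (J i)) {c : M.BraidMonoid} (h : ∀ i < K, u i ∣ c) :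
    seqProd u K ∣ c := by
  have hmem : ∀ k, seqProd u k ∈ M.parabolic (⋃ i ∈ Set.Iio k, J i) := by
    intro k
    induction k with
    | zero => exact one_mem _
    | succ k ih =>
      refine mul_mem (parabolic_mono ?_ ih) (parabolic_mono ?_ (hu k))
      · exact Set.biUnion_subset_biUnion_left fun i hi => Nat.lt_succ_of_lt hi
      · exact Set.subset_biUnion_of_mem (u := J) (Set.mem_Iio.2 k.lt_succ_self)
  induction K with
  | zero => exact one_dvd c
  | succ K ih =>
    obtain ⟨d, rfl⟩ := ih (fun i j hi hj => hJ i j hi (by omega)) fun i hi => h i (by omega)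
    rw [seqProd, mul_dvd_mul_iff_left_of_isSimplyLaced hM]
    refine dvd_of_dvd_mul hM (fun s hs t ht => ?_) (hmem K) (hu K) (h K (by omega))
    obtain ⟨i, hi, hs⟩ := Set.mem_iUnion₂.1 hs
    exact hJ i K hi (by omega) s hs t ht

/-- The alternating product of two layers is a least common multiple of them. -/
theorem altProd_layer_dvd (hst : s ≠ t) (hn : M s t = n + 1) {K : ℕ} {c : M.unfolding.BraidMonoid}
    (hs : M.layer (K * n) s ∣ c) (ht : M.layer (K * n) t ∣ c) :
    altProd (M.layer (K * n) s) (M.layer (K * n) t) (M s t) ∣ c := by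
  rw [altProd_layer hst hn]
  refine seqProd_dvd M.unfolding_isSimplyLaced (J := fun j => chain s t n j '' Set.Iio n) ?_
    (fun j => halfTwist_mem_parabolic _ n) fun j hj => ?_
  · rintro j j' hj - _ ⟨i, hi, rfl⟩ _ ⟨i', hi', rfl⟩
    exact unfolding_chain_eq_two hn hj.ne hi hi'
  · refine (chain_isChain hst hn j).halfTwist_dvd M.unfolding_isSimplyLaced fun i hi => ?_
    have hx : j / 2 * n + i < K * n := by
      calc j / 2 * n + i < (j / 2 + 1) * n := by rw [add_one_mul]; omega
        _ ≤ K * n := Nat.mul_le_mul_right n (by omega)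
    rw [chain]
    split_ifs
    · exact (gen_dvd_layer s hx).trans hs
    · exact (gen_dvd_layer t hx).trans ht

variable (M) in
/-- The homomorphism from a braid monoid to the braid monoid of the unfolding that maps each
generator to its layer. -/
noncomputable def unfold (N : ℕ) (h₀ : ∀ s t, M s t ≠ 0) (hN : ∀ s t, s ≠ t → M s t - 1 ∣ N) :
    M.BraidMonoid →* M.unfolding.BraidMonoid :=
  M.braidLift (M.layer N) (by
    intro s t hst
    obtain ⟨K, rfl⟩ := exists_eq_mul_left_of_dvd (hN s t hst)
    have hn : M s t = (M s t - 1) + 1 := (Nat.sub_one_add_one (h₀ s t)).symm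
    rw [altProd_layer hst hn, altProd_layer_swap hst hn])

theorem length_unfold {N : ℕ} (h₀ : ∀ s t, M s t ≠ 0) (hN : ∀ s t, s ≠ t → M s t - 1 ∣ N)
    (b : M.BraidMonoid) : M.unfolding.length (M.unfold N h₀ hN b) = N * M.length b := by
  induction hb : M.length b generalizing b with
  | zero => simp [eq_one_of_length_eq_zero hb]
  | succ k ih =>
    rcases M.eq_one_or_eq_gen_mul b with rfl | ⟨s, c, rfl⟩
    · simp at hb
    · rw [length_mul, length_gen] at hb
      rw [map_mul, length_mul, ih c (by omega), mul_add_one, add_comm, unfold, braidLift_gen,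
        length_layer]

/-! ### Homomorphisms that respect least common multiples -/

variable {A : Type*} [Monoid A]

/-- A homomorphism from a braid monoid to a left cancellative monoid respects least common multiples
if it maps generators to elements without right inverse, and the least common multiple of two
generators to a least common multiple of their images. -/
structure IsLcmHom (f : M.BraidMonoid →* A) : Prop where
  cancel : ∀ a b c : A, a * b = a * c → b = c
  not_dvd_one : ∀ s, ¬ f (M.gen s) ∣ 1
  two_le : ∀ s t, s ≠ t → 2 ≤ M s t
  lcm_dvd : ∀ s t c, s ≠ t → f (M.gen s) ∣ c → f (M.gen t) ∣ c →
    altProd (f (M.gen s)) (f (M.gen t)) (M s t) ∣ c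

variable {f : M.BraidMonoid →* A}

/-- Divisibility by generators is reflected: if the images of `s` and of `t` divide the image of
`t c`, so does their least common multiple, and its remaining factors can be found in `c` by
induction on the length. -/
theorem IsLcmHom.gen_dvd (hf : IsLcmHom f) {s : B} {b : M.BraidMonoid} (h : f (M.gen s) ∣ f b) :
    M.gen s ∣ b := by
  have hdvd : ∀ a b c : A, a * b ∣ a * c → b ∣ c := fun a b c ⟨d, hd⟩ =>
    ⟨d, hf.cancel a _ _ (hd.trans (mul_assoc _ _ _))⟩
  induction hb : M.length b using Nat.strong_induction_on generalizing b s with | _ k ih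
  rcases M.eq_one_or_eq_gen_mul b with rfl | ⟨t, c, rfl⟩
  · exact absurd (by simpa using h) (hf.not_dvd_one s)
  rcases eq_or_ne s t with rfl | hst
  · exact dvd_mul_right _ _
  rw [length_mul, length_gen] at hb
  -- Alternating products can be split off one factor at a time.
  have peel : ∀ (m : ℕ) (s t : B) (c : M.BraidMonoid), M.length c < k →
      altProd (f (M.gen s)) (f (M.gen t)) m ∣ f c → altProd (M.gen s) (M.gen t) m ∣ c := by
    intro m
    induction m with
    | zero => exact fun _ _ _ _ _ => one_dvd _
    | succ m ihm =>
      intro s t c hc h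
      obtain ⟨d, rfl⟩ := ih _ hc ((dvd_mul_right _ _).trans h) rfl
      rw [map_mul] at h
      rw [length_mul, length_gen] at hc
      exact mul_dvd_mul_left _ (ihm t s d (by omega) (hdvd _ _ _ h))
  obtain ⟨m, hm⟩ : ∃ m, M t s = m + 1 := ⟨M t s - 1, by have := hf.two_le t s hst.symm; omega⟩
  have h' := hf.lcm_dvd t s (f (M.gen t * c)) hst.symm (by rw [map_mul]; exact dvd_mul_right _ _) h
  rw [hm, altProd, map_mul] at h'
  have h'' := mul_dvd_mul_left (M.gen t) (peel m s t c (by omega) (hdvd _ _ _ h'))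
  change altProd (M.gen t) (M.gen s) (m + 1) ∣ _ at h''
  rw [← hm, M.altProd_gen, hm] at h''
  exact (dvd_mul_right _ _).trans h''

theorem IsLcmHom.eq_of_map_eq (hf : IsLcmHom f) {b c : M.BraidMonoid} (hl : M.length b = M.length c)
    (h : f b = f c) : b = c := by
  induction hn : M.length b generalizing b c with
  | zero => rw [eq_one_of_length_eq_zero hn, eq_one_of_length_eq_zero (hl.symm.trans hn)]
  | succ n ih =>
    rcases M.eq_one_or_eq_gen_mul b with rfl | ⟨s, b, rfl⟩
    · simp at hn
    obtain ⟨c, rfl⟩ : M.gen s ∣ c := hf.gen_dvd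
      (h ▸ map_mul f _ _ ▸ dvd_mul_right _ _)
    rw [map_mul, map_mul] at h
    simp only [length_mul, length_gen] at hn hl
    rw [ih (by omega) (hf.cancel _ _ _ h) (by omega)]

end CoxeterMatrix

/-! ### The embedding of the braid monoid into the braid group -/

namespace CoxeterMatrix

variable {B : Type u} {M : CoxeterMatrix B}

/-- Elements of the braid monoid with equal images in the braid group have equal images in every
group. -/
theorem map_eq_of_braidMonoidToGroup_eq {G : Type*} [Group G] (f : M.BraidMonoid →* G)
    {b c : M.BraidMonoid} (h : M.braidMonoidToGroup b = M.braidMonoidToGroup c) : f b = f c := by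
  have hrel : ∀ r ∈ M.groupBraidRels, FreeGroup.lift (fun s => f (M.gen s)) r = 1 := by
    rintro _ ⟨s, t, rfl⟩
    have key : ∀ l : List B, FreeGroup.lift (fun s => f (M.gen s)) (l.map FreeGroup.of).prod =
        f (PresentedMonoid.mk _ (FreeMonoid.ofList l)) := by
      intro l
      induction l with
      | nil => simp
      | cons a l ih =>
        rw [List.map_cons, List.prod_cons, map_mul, ih, FreeMonoid.ofList_cons, map_mul, map_mul,
          FreeGroup.lift_apply_of]
        rfl
    rw [map_mul, map_inv, key, key, PresentedMonoid.mk_eq_mk_of_rel ⟨s, t, rfl, rfl⟩,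
      mul_inv_cancel]
  have e : (PresentedGroup.toGroup hrel).comp M.braidMonoidToGroup = f := by
    refine PresentedMonoid.ext _ fun s => ?_
    exact PresentedGroup.toGroup.of hrel
  rw [← e, MonoidHom.comp_apply, MonoidHom.comp_apply, h]

theorem length_eq_of_braidMonoidToGroup_eq {b c : M.BraidMonoid}
    (h : M.braidMonoidToGroup b = M.braidMonoidToGroup c) : M.length b = M.length c := by
  -- The length of a braid is defined in the braid group, with values in the integers.
  have := map_eq_of_braidMonoidToGroup_eq
    ((AddMonoidHom.toMultiplicative (Nat.castAddMonoidHom ℤ)).comp M.len) h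
  exact Int.ofNat_inj.1 (Multiplicative.ofAdd.injective this)

theorem braidMonoidToGroup_injective_of_bounded {N : ℕ} (h₀ : ∀ s t, M s t ≠ 0) (hpos : 0 < N)
    (hN : ∀ s t, s ≠ t → M s t - 1 ∣ N) : Function.Injective M.braidMonoidToGroup := by
  intro b c h
  have hl := length_eq_of_braidMonoidToGroup_eq h
  have h₂ : ∀ s t, s ≠ t → 2 ≤ M s t := fun s t hst => by
    have := h₀ s t
    have := M.off_diagonal s t hst
    omega
  have hU := M.unfolding_isSimplyLaced
  refine IsLcmHom.eq_of_map_eq (f := M.unfold N h₀ hN)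
    ⟨fun a _ _ => mul_left_cancel_of_isSimplyLaced hU a, ?_, h₂, ?_⟩ hl ?_
  · rintro s ⟨d, hd⟩
    have := congrArg M.unfolding.length hd
    rw [length_mul, length_unfold, length_one, length_gen] at this
    omega
  · intro s t c hst hs ht
    obtain ⟨K, rfl⟩ := exists_eq_mul_left_of_dvd (hN s t hst)
    exact altProd_layer_dvd hst (Nat.sub_one_add_one (h₀ s t)).symm hs ht
  · refine eq_of_orbit_eq hU (by rw [length_unfold, length_unfold, hl]) ?_
    have := map_eq_of_braidMonoidToGroup_eq ((M.unfolding.twistAction hU).comp (M.unfold N h₀ hN)) h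
    exact congrArg (fun e => e (Zigzag.DGMod.base M.unfolding.graph).cls) this

/-- A relation in the braid group involves only finitely many entries of the Coxeter matrix. -/
theorem exists_finset_of_mem_normalClosure {r : FreeGroup B}
    (hr : r ∈ Subgroup.normalClosure M.groupBraidRels) :
    ∃ F : Finset (B × B), ∀ M' : CoxeterMatrix B,
      (∀ p ∈ F, M p.1 p.2 ≠ 0 → M' p.1 p.2 = M p.1 p.2) →
        r ∈ Subgroup.normalClosure M'.groupBraidRels := by
  classical
  let K : Subgroup (FreeGroup B) :=
    { carrier := {r | ∃ F : Finset (B × B), ∀ M' : CoxeterMatrix B,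
        (∀ p ∈ F, M p.1 p.2 ≠ 0 → M' p.1 p.2 = M p.1 p.2) →
          r ∈ Subgroup.normalClosure M'.groupBraidRels}
      one_mem' := ⟨∅, fun M' _ => one_mem _⟩
      mul_mem' := fun ⟨F, hF⟩ ⟨F', hF'⟩ => ⟨F ∪ F', fun M' h =>
        mul_mem (hF M' fun p hp => h p (Finset.mem_union_left _ hp))
          (hF' M' fun p hp => h p (Finset.mem_union_right _ hp))⟩
      inv_mem' := fun ⟨F, hF⟩ => ⟨F, fun M' h => inv_mem (hF M' h)⟩ }
  have hK : K.Normal := ⟨fun a ⟨F, hF⟩ g =>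
    ⟨F, fun M' h => Subgroup.normalClosure_normal.conj_mem _ (hF M' h) g⟩⟩
  refine Subgroup.normalClosure_le_normal (N := K) ?_ hr
  rintro _ ⟨s, t, rfl⟩
  refine ⟨{(s, t)}, fun M' h => ?_⟩
  by_cases h₀ : M s t = 0
  · simp [CoxeterSystem.braidWord, M.symmetric t s, h₀, CoxeterSystem.alternatingWord]
  · refine Subgroup.subset_normalClosure ⟨s, t, ?_⟩
    have := h (s, t) (by simp) h₀
    simp only at this
    rw [CoxeterSystem.braidWord, CoxeterSystem.braidWord, CoxeterSystem.braidWord,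
      CoxeterSystem.braidWord, M.symmetric t s, M'.symmetric t s, this]

open Classical in
/-- The Coxeter matrix that agrees with `M` at the finite entries in a set of pairs, and has a given
value elsewhere off the diagonal. -/
noncomputable def truncate (M : CoxeterMatrix B) (F : Finset (B × B)) (L : ℕ) (hL : L ≠ 1) :
    CoxeterMatrix B where
  M := Matrix.of fun s t => if s = t then 1 else
    if ((s, t) ∈ F ∨ (t, s) ∈ F) ∧ M s t ≠ 0 then M s t else L
  isSymm := by
    ext s t
    simp only [Matrix.transpose_apply, Matrix.of_apply, eq_comm (a := s), M.symmetric s,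
      or_comm (a := (s, t) ∈ F)]
  diagonal s := by simp
  off_diagonal s t h := by
    simp only [Matrix.of_apply, h, if_false]
    split_ifs
    · exact M.off_diagonal s t h
    · exact hL

theorem truncate_of_mem {F : Finset (B × B)} {L : ℕ} (hL : L ≠ 1) {p : B × B} (hp : p ∈ F)
    (h₀ : M p.1 p.2 ≠ 0) : M.truncate F L hL p.1 p.2 = M p.1 p.2 := by
  by_cases h : p.1 = p.2
  · rw [h, diagonal, diagonal]
  · exact (if_neg h).trans (if_pos ⟨.inl hp, h₀⟩)

theorem truncate_cases {F : Finset (B × B)} {L : ℕ} (hL : L ≠ 1) {s t : B} (h : s ≠ t) :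
    (((s, t) ∈ F ∨ (t, s) ∈ F) ∧ M s t ≠ 0 ∧ M.truncate F L hL s t = M s t) ∨
      M.truncate F L hL s t = L := by
  have e : M.truncate F L hL s t = _ := if_neg h
  rw [e]
  split_ifs with h'
  · exact .inl ⟨h'.1, h'.2, rfl⟩
  · exact .inr rfl

/-- Changing entries of the Coxeter matrix does not affect the equality of words shorter than the
new entries. -/
theorem mk_eq_mk_of_truncate {F : Finset (B × B)} {L : ℕ} (hL : L ≠ 1) {v w : FreeMonoid B}
    (hv : v.length < L) (h : PresentedMonoid.mk (M.truncate F L hL).MonoidBraidRel v =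
      PresentedMonoid.mk (M.truncate F L hL).MonoidBraidRel w) :
    PresentedMonoid.mk M.MonoidBraidRel v = PresentedMonoid.mk M.MonoidBraidRel w := by
  -- On words of length at least `L`, such as the two sides of a new relation, the congruence `c` only
  -- compares lengths.
  let c : Con (FreeMonoid B) :=
    { r := fun v w => v.length = w.length ∧ (v.length < L →
        PresentedMonoid.mk M.MonoidBraidRel v = PresentedMonoid.mk M.MonoidBraidRel w)
      iseqv :=
        ⟨fun v => ⟨rfl, fun _ => rfl⟩, fun h => ⟨h.1.symm, fun h' => (h.2 (h.1 ▸ h')).symm⟩,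
          fun h h' => ⟨h.1.trans h'.1, fun e => (h.2 e).trans (h'.2 (h.1 ▸ e))⟩⟩
      mul' := fun {a b a' b'} h h' => by
        refine ⟨by rw [FreeMonoid.length_mul, FreeMonoid.length_mul, h.1, h'.1], fun e => ?_⟩
        rw [FreeMonoid.length_mul] at e
        rw [map_mul, map_mul, h.2 (by omega), h'.2 (by omega)] }
  have hc : conGen (M.truncate F L hL).MonoidBraidRel ≤ c := by
    refine Con.conGen_le.2 ?_
    rintro _ _ ⟨s, t, rfl, rfl⟩
    have hs := (M.truncate F L hL).symmetric t s
    refine ⟨?_, fun e => ?_⟩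
    · change (CoxeterSystem.braidWord _ s t).length = (CoxeterSystem.braidWord _ t s).length
      simp [hs]
    · rcases eq_or_ne s t with rfl | hst
      · rfl
      rcases M.truncate_cases (F := F) hL hst with ⟨-, -, h⟩ | h
      · refine PresentedMonoid.mk_eq_mk_of_rel ⟨s, t, ?_, ?_⟩
        · rw [CoxeterSystem.braidWord, h]
        · rw [CoxeterSystem.braidWord, hs, h, M.symmetric s t]
      · have e : (CoxeterSystem.braidWord (M.truncate F L hL) s t).length < L := e
        rw [CoxeterSystem.length_alternatingWord, h] at e
        omega
  exact (hc (PresentedMonoid.mk_eq_mk_iff.1 h)).2 hv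

theorem braidMonoidToGroup_mk (M : CoxeterMatrix B) (l : FreeMonoid B) :
    M.braidMonoidToGroup (PresentedMonoid.mk _ l) =
      PresentedGroup.mk M.groupBraidRels (FreeMonoid.lift FreeGroup.of l) := by
  induction l using FreeMonoid.recOn with
  | one => simp
  | of_mul s l ih => rw [map_mul, map_mul, ih, map_mul, map_mul]; rfl

theorem braidMonoidToGroup_injective (M : CoxeterMatrix B) :
    Function.Injective M.braidMonoidToGroup := by
  classical
  intro b c h
  obtain ⟨v, rfl⟩ := PresentedMonoid.surjective_mk b
  obtain ⟨w, rfl⟩ := PresentedMonoid.surjective_mk c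
  rw [braidMonoidToGroup_mk, braidMonoidToGroup_mk] at h
  obtain ⟨F, hF⟩ := exists_finset_of_mem_normalClosure (QuotientGroup.eq.1 h)
  -- The bound `N` is divisible by all `M s t - 1` that matter, and exceeds the length of the words. The
  -- new entry `N + 1` is compatible with it.
  let P := ∏ p ∈ F, max (M p.1 p.2 - 1) 1
  have hP : 0 < P := Finset.prod_pos fun p _ => by simp
  let N := P * (v.length + 1)
  have hNpos : 0 < N := by positivity
  have hvN : v.length < N := Nat.lt_of_succ_le (Nat.le_mul_of_pos_left _ hP)
  have hL : N + 1 ≠ 1 := by omega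
  let M' := M.truncate F (N + 1) hL
  refine mk_eq_mk_of_truncate (F := F) hL (by omega) ?_
  refine braidMonoidToGroup_injective_of_bounded (M := M') (N := N) (fun s t => ?_) hNpos
    (fun s t hst => ?_) ?_
  · rcases eq_or_ne s t with rfl | hst
    · simp
    rcases M.truncate_cases (F := F) hL hst with ⟨-, h₀, h⟩ | h
    · exact h.trans_ne h₀
    · exact h.trans_ne (by omega)
  · rcases M.truncate_cases (F := F) hL hst with ⟨hF, h₀, h⟩ | h
    · rw [h]
      have h₁ := M.off_diagonal s t hst
      have hd : ∀ p ∈ F, M p.1 p.2 = M s t → M s t - 1 ∣ P := fun p hp e => by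
        have := Finset.dvd_prod_of_mem (fun p : B × B => max (M p.1 p.2 - 1) 1) hp
        simp only [e] at this
        rwa [max_eq_left (by omega)] at this
      refine Dvd.dvd.mul_right ?_ _
      rcases hF with hF | hF
      · exact hd _ hF rfl
      · exact hd _ hF (M.symmetric t s)
    · rw [h]
      simp
  · rw [braidMonoidToGroup_mk, braidMonoidToGroup_mk]
    exact QuotientGroup.eq.2 (hF M' fun p hp h₀ => truncate_of_mem hL hp h₀)

end CoxeterMatrix

theorem mainTheorem4 {B W : Type*} [Group W] {M : CoxeterMatrix B} (cs : CoxeterSystem M W) :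
    Function.Injective cs.braidMonoidToGroup :=
  M.braidMonoidToGroup_injective
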